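/- Let $\mathbb F$ be $\mathbb R$ or $\mathbb C$. **Conventions.** For families of nonnegative numbers, $\alpha_m\approx\beta_m$ means that there is a constant $C\in(0,\infty)$ with $\alpha_m\le C\beta_m$ and $\beta_m\le C\alpha_m$ for all $m\ge 1$. Let $\sigma=(s_m)_{m=1}^\infty$ be a sequence of positive numbers. It is *essentially increasing* if there is $C$ with $s_m\le C s_n$ whenever $m\le n$; its *dual sequence* is $\sigma^*=(m/s_m)_{m=1}^\infty$; it has the *LRP* if there is $r\in\mathbb N$ with $s_{rn}\ge 2s_n$ for all $n\ge1$, and the *URP* if $\sigma^*$ has the LRP. A *non-increasing weight* is a non-increasing sequence $w=(w_n)_{n=1}^\infty$ in $[0,\infty)$ with $w_1>0$; its primitive sequence $\sigma[w]$ is given by $\sigma[w]_m=\sum_{n=1}^m w_n$. Let $\mathcal X=(x_n)_{n=1}^\infty$ be a Schauder basis of a Banach space $\mathbb X$ over $\mathbb F$, with coordinate functionals $\mathcal X^*=(x_n^*)_{n=1}^\infty$ in $\mathbb X^*$, and let $S_A(f)=\sum_{n\in A}x_n^*(f)\,x_n$. Put $$\varphi_m[\mathcal X,\mathbb X]=\sup\Big\{\Big\|\sum_{n\in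 A}\varepsilon_n x_n\Big\| : |A|\le m,\ |\varepsilon_n|=1\Big\},\qquad k_m=\sup_{|A|\le m}\|S_A\|,$$ $$\tilde k_m=\sup\{\|S_A(f)\| : A\subset\mathbb N,\ \|f\|\le1,\ x_n^*(f)=0 \text{ for } n>m\}.$$ The basis is *bidemocratic* if there is $C$ with $\varphi_m[\mathcal X,\mathbb X]\,\varphi_m[\mathcal X^*,\mathbb X^*]\le Cm$ for all $m\ge 1$. It has *Property (A)* if $\|x\|=\|y\|$ whenever $x=\sum a_nx_n$ and $y=\sum b_nx_n$ in $\mathbb X$ are such that, for some bijection $\pi$ of $\mathbb N$, $|b_{\pi(n)}|=|a_n|$ for all $n$, and $\pi(k)=k$ and $b_k=a_k$ whenever $0<|a_k|<\sup_n|a_n|$. **Statement.** There exist Banach spaces $\mathbb X$ over $\mathbb F$ with a bidemocratic Schauder basis $\mathcal X$ that has Property (A) and is not unconditional. In fact, let $\sigma=(s_m)_{m=1}^\infty$ be an essentially increasing sequence of positive numbers whose dual sequence $\sigma^*$ is also essentially increasing. 1. (C.1) If $\sigma$ and $\sigma^*$ are unbounded and $w$ is a non-increasing weight with $\sigma[w]_m\approx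 s_m$, then $\mathbb X$ and $\mathcal X$ as above can be chosen so that $\varphi_m[\mathcal X,\mathbb X]=\sigma[w]_m$ for all $m\ge1$, and hence $\varphi_m[\mathcal X,\mathbb X]\approx s_m$. 2. (C.2) If $\sigma$ has the LRP and $\sigma^*$ is unbounded, then there is a non-increasing weight $w$ with $\sigma[w]_m\approx s_m$, and for each such $w$ there are $\mathbb X$ and $\mathcal X$ as in 1. 3. (C.3) If $\sigma$ has the LRP and the URP, then there is a non-increasing weight $w$ with $\sigma[w]_m\approx s_m$, and for each such $w$ there are $\mathbb X$ and $\mathcal X$ as in 1 which satisfy in addition $k_m\approx\tilde k_m\approx\log(1+m)$. -/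

import Mathlib

universe u

open scoped NNReal ENNReal

noncomputable section

/-! ### Sequences of scalars

A sequence `(s_m)_{m ≥ 1}` is a function `ℕ → ℝ` of which only the values at `m ≥ 1` matter;
the value at `0` enters none of the notions below. -/

/-- `a_m ≈ b_m` for `m ≥ 1`. -/
def SeqEquiv (a b : ℕ → ℝ) : Prop :=
  ∃ C : ℝ, 0 < C ∧ ∀ m, 1 ≤ m → a m ≤ C * b m ∧ b m ≤ C * a m

/-- `a_m ≈ b_m` for `m ≥ 1`, for quantities which are defined as suprema and are
a priori allowed to be infinite; the constant is finite. -/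
def ENNSeqEquiv (a b : ℕ → ℝ≥0∞) : Prop :=
  ∃ C : ℝ≥0, ∀ m, 1 ≤ m → a m ≤ C * b m ∧ b m ≤ C * a m

/-- Essentially increasing sequences. -/
def EssIncreasing (s : ℕ → ℝ) : Prop :=
  ∃ C : ℝ, 0 < C ∧ ∀ m n, 1 ≤ m → m ≤ n → s m ≤ C * s n

/-- The dual sequence `(n / s_n)_{n ≥ 1}`. -/
def dualSeq (s : ℕ → ℝ) (n : ℕ) : ℝ := n / s n

/-- Unboundedness (from above) of a sequence of positive numbers. -/
def UnboundedSeq (s : ℕ → ℝ) : Prop :=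
  ∀ C : ℝ, ∃ m, 1 ≤ m ∧ C < s m

/-- The lower regularity property. -/
def LRP (s : ℕ → ℝ) : Prop :=
  ∃ r : ℕ, 1 ≤ r ∧ ∀ n, 1 ≤ n → 2 * s n ≤ s (r * n)

/-- The upper regularity property. -/
def URP (s : ℕ → ℝ) : Prop := LRP (dualSeq s)

/-- Non-increasing weights `(w_n)_{n ≥ 1}`: non-negative sequences with `w_1 > 0`
that are non-increasing. -/
structure IsNonincreasingWeight (w : ℕ → ℝ) : Prop where
  nonneg : ∀ n, 1 ≤ n → 0 ≤ w n
  pos_one : 0 < w 1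
  nonincreasing : ∀ m n, 1 ≤ m → m ≤ n → w n ≤ w m

/-- The primitive sequence `∑_{n=1}^m w_n` of a weight. -/
def primitiveSeq (w : ℕ → ℝ) (m : ℕ) : ℝ := ∑ n ∈ Finset.Icc 1 m, w n

/-! ### Bases

Bases are indexed by `ℕ = {0, 1, 2, …}`, so that `b n` is the `(n+1)`-st basis vector. -/

section Bases

variable {𝕜 X : Type*} [RCLike 𝕜] [NormedAddCommGroup X] [NormedSpace 𝕜 X]

/-- The fundamental function of a sequence of vectors: the supremum of
`‖∑_{n ∈ A} ε_n x_n‖` over `|A| ≤ m` and `|ε_n| = 1`. -/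
def fundamentalFunction (𝕜 : Type*) {E : Type*} [RCLike 𝕜] [NormedAddCommGroup E]
    [NormedSpace 𝕜 E] (x : ℕ → E) (m : ℕ) : ℝ≥0∞ :=
  ⨆ (A : Finset ℕ) (_ : A.card ≤ m) (ε : ℕ → 𝕜) (_ : ∀ n ∈ A, ‖ε n‖ = 1),
    ‖∑ n ∈ A, ε n • x n‖ₑ

/-- Bidemocratic bases; the coordinate functionals are taken with the norm of the dual space. -/
def IsBidemocratic (b : SchauderBasis 𝕜 X) : Prop :=
  ∃ C : ℝ≥0, ∀ m : ℕ, 1 ≤ m →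
    fundamentalFunction 𝕜 b.basis m * fundamentalFunction 𝕜 b.coord m ≤ C * m

/-- Unconditional bases: the expansion of every vector converges unconditionally. -/
def IsUnconditional (b : SchauderBasis 𝕜 X) : Prop :=
  ∀ x : X, Summable fun n => b.coord n x • b n

/-- `y` is a greedy rearrangement of `x`: the coefficients of `x` of maximal modulus are
relocated (to positions which carry no other non-zero coefficient of `x`) and rotated,
and the remaining non-zero coefficients are untouched. The condition
`∃ n, ‖b.coord k x‖ < ‖b.coord n x‖` says that the modulus of the `k`-th coefficient is
smaller than the supremum of the moduli. -/
def IsGreedyRearrangement (b : SchauderBasis 𝕜 X) (x y : X) : Prop :=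
  ∃ π : Equiv.Perm ℕ,
    (∀ n, ‖b.coord (π n) y‖ = ‖b.coord n x‖) ∧
    ∀ k, b.coord k x ≠ 0 → (∃ n, ‖b.coord k x‖ < ‖b.coord n x‖) →
      π k = k ∧ b.coord k y = b.coord k x

/-- Property (A). -/
def HasPropertyA (b : SchauderBasis 𝕜 X) : Prop :=
  ∀ x y : X, IsGreedyRearrangement b x y → ‖x‖ = ‖y‖

/-- The unconditionality parameters `k_m = sup_{|A| ≤ m} ‖S_A‖`. -/
def uncondParam (b : SchauderBasis 𝕜 X) (m : ℕ) : ℝ≥0∞ :=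
  ⨆ (A : Finset ℕ) (_ : A.card ≤ m), ‖GeneralSchauderBasis.proj b A‖ₑ

/-- The unconditionality parameters `k̃_m`: the supremum of `‖S_A f‖` over all sets `A` and all `f`
in the unit ball supported on the first `m` basis vectors. As such an `f` is finitely supported,
finite sets `A` give all the vectors `S_A f`. -/
def uncondParamTilde (b : SchauderBasis 𝕜 X) (m : ℕ) : ℝ≥0∞ :=
  ⨆ (A : Finset ℕ) (f : X) (_ : ‖f‖ ≤ 1) (_ : ∀ n, m ≤ n → b.coord n f = 0),
    ‖GeneralSchauderBasis.proj b A f‖ₑ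

end Bases

end

/-!
Complete the finitely supported sequences `(a_n)_{n ≥ 1}` in the norm given by the supremum, over
finite `B ⊆ ℕ` and `N ∈ ℕ`, of
`(σ[w]_{|B|} / |B|) ∑_{n ∈ B} |a_n| + ½ |∑_{n ≤ N, n ∉ B} w_{|B|+n} a_n|`.

The first summand gives a Marcinkiewicz norm. It bounds the norm of `∑_{n ∈ A} x_n^*` by
`|A| / σ[w]_{|A|}`, while the second summand adds at most what is left of the mass of `w`, so that
the fundamental function of the basis is exactly `σ[w]`; hence bidemocracy. Coordinates of maximal
modulus can be moved into `B` without decreasing the seminorm, because the weight outside `B` is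
shifted by `|B|`; once they are in `B` only their number matters, which is Property (A).

The second summand sees only partial sums. A vector with coefficients `c_1, -c_2, c_3, …`, where
`c` is non-increasing with Marcinkiewicz norm at most `2`, has bounded norm, but projecting it onto
every other coordinate destroys the cancellation and leaves a norm of order `∑ w_n c_n`. This sum
is made large by adding flat blocks of widely different lengths; under the LRP and the URP the
choice `c_n = 1 / σ[w]_n` gives `∑ w_n c_n ≈ ∑ 1 / n`.
-/

/-! ### Completing the finitely supported sequences -/

section Completion

variable {𝕜 : Type u} [NontriviallyNormedField 𝕜]

section Grunblum

variable {X : Type*} [NormedAddCommGroup X] [NormedSpace 𝕜 X]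

theorem tendsto_of_dense_of_norm_le {s : Set X} (hs : Dense s) {S : ℕ → X →L[𝕜] X} {C : ℝ}
    (hC : ∀ M x, ‖S M x‖ ≤ C * ‖x‖)
    (h : ∀ x ∈ s, Filter.Tendsto (fun M => S M x) Filter.atTop (nhds x)) (x : X) :
    Filter.Tendsto (fun M => S M x) Filter.atTop (nhds x) := by
  have heq : Equicontinuous fun M => ⇑(S M) :=
    ((NormedSpace.equicontinuous_TFAE S).out 1 3 :).mpr ⟨C, hC⟩
  exact closure_minimal h (heq.isClosed_setOfPred_tendsto continuous_id) (hs x)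

variable {e : ℕ → X} {C : ℝ}

theorem norm_coeff_le_of_norm_filter_le (he : ∀ n, e n ≠ 0)
    (hC : ∀ (a : ℕ →₀ 𝕜) (M : ℕ), ‖Finsupp.linearCombination 𝕜 e (a.filter (· < M))‖ ≤
      C * ‖Finsupp.linearCombination 𝕜 e a‖) (n : ℕ) (a : ℕ →₀ 𝕜) :
    ‖a n‖ ≤ 2 * C / ‖e n‖ * ‖Finsupp.linearCombination 𝕜 e a‖ := by
  have hdiff : Finsupp.single n (a n) = a.filter (· < n + 1) - a.filter (· < n) := by
    ext k
    simp only [Finsupp.coe_sub, Pi.sub_apply, Finsupp.filter_apply, Finsupp.single_apply]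
    grind
  rw [div_mul_eq_mul_div, le_div_iff₀ (norm_pos_iff.mpr (he n))]
  calc ‖a n‖ * ‖e n‖
      = ‖Finsupp.linearCombination 𝕜 e (a.filter (· < n + 1)) -
          Finsupp.linearCombination 𝕜 e (a.filter (· < n))‖ := by
        rw [← map_sub, ← hdiff, Finsupp.linearCombination_single, norm_smul]
    _ ≤ C * ‖Finsupp.linearCombination 𝕜 e a‖ + C * ‖Finsupp.linearCombination 𝕜 e a‖ :=
        (norm_sub_le _ _).trans (add_le_add (hC a _) (hC a _))
    _ = 2 * C * ‖Finsupp.linearCombination 𝕜 e a‖ := by ring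

theorem sum_range_smul_eq_linearCombination_filter (a : ℕ →₀ 𝕜) (M : ℕ) :
    ∑ n ∈ Finset.range M, a n • e n = Finsupp.linearCombination 𝕜 e (a.filter (· < M)) := by
  have hsupp : (a.filter (· < M)).support ⊆ Finset.range M := by
    intro n hn
    rw [Finsupp.support_filter, Finset.mem_filter] at hn
    exact Finset.mem_range.mpr hn.2
  rw [Finsupp.linearCombination_apply, Finsupp.sum_of_support_subset _ hsupp _ (by simp)]
  exact Finset.sum_congr rfl fun n hn => by
    rw [Finsupp.filter_apply_pos (· < M) a (Finset.mem_range.mp hn)]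

/-- Grünblum's criterion. -/
theorem exists_schauderBasis_of_norm_filter_le [CompleteSpace 𝕜] (he : ∀ n, e n ≠ 0)
    (hdense : DenseRange (Finsupp.linearCombination 𝕜 e))
    (hC : ∀ (a : ℕ →₀ 𝕜) (M : ℕ), ‖Finsupp.linearCombination 𝕜 e (a.filter (· < M))‖ ≤
      C * ‖Finsupp.linearCombination 𝕜 e a‖) :
    ∃ b : SchauderBasis 𝕜 X, b.basis = e := by
  let f (n : ℕ) : StrongDual 𝕜 X :=
    (Finsupp.lapply n : (ℕ →₀ 𝕜) →ₗ[𝕜] 𝕜).extendOfNorm (Finsupp.linearCombination 𝕜 e)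
  have hf (n : ℕ) (a : ℕ →₀ 𝕜) : f n (Finsupp.linearCombination 𝕜 e a) = a n :=
    LinearMap.extendOfNorm_eq hdense ⟨_, norm_coeff_le_of_norm_filter_le he hC n⟩ a
  let S (M : ℕ) : X →L[𝕜] X := ∑ n ∈ Finset.range M, (f n).smulRight (e n)
  have hS (M : ℕ) (x : X) : S M x = ∑ n ∈ Finset.range M, f n x • e n := by
    simp [S, _root_.sum_apply]
  have hS_range (M : ℕ) (a : ℕ →₀ 𝕜) : S M (Finsupp.linearCombination 𝕜 e a) =
      Finsupp.linearCombination 𝕜 e (a.filter (· < M)) := by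
    simp only [hS, hf, sum_range_smul_eq_linearCombination_filter]
  have hS_norm (M : ℕ) (x : X) : ‖S M x‖ ≤ C * ‖x‖ :=
    hdense.induction (by rintro _ ⟨a, rfl⟩; exact hS_range M a ▸ hC a M)
      (isClosed_le (by fun_prop) (by fun_prop)) x
  have hS_tendsto (x : X) : Filter.Tendsto (fun M => S M x) Filter.atTop (nhds x) := by
    refine tendsto_of_dense_of_norm_le hdense hS_norm ?_ x
    rintro _ ⟨a, rfl⟩
    refine tendsto_const_nhds.congr' ?_
    filter_upwards [Filter.eventually_gt_atTop (a.support.sup id)] with M hM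
    rw [hS_range, (Finsupp.filter_eq_self_iff _ _).mpr]
    exact fun n hn => (Finset.le_sup (f := id) (Finsupp.mem_support_iff.mpr hn)).trans_lt hM
  exact ⟨{  basis := e
            coord := f
            ortho := fun i j => by
              have h := hf i (Finsupp.single j 1)
              rw [Finsupp.linearCombination_single, one_smul] at h
              rw [h, Finsupp.single_eq_pi_single]
              congr
            expansion := fun x => by
              rw [HasSum, SummationFilter.conditional_filter_eq_map_range,
                Filter.tendsto_map'_iff]
              exact (hS_tendsto x).congr fun M => hS M x }, rfl⟩

end Grunblum

variable {ι : Type*} {q : ι → Seminorm 𝕜 (ℕ → 𝕜)}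

theorem exists_norm_linearCombination_eq_iSup [Nonempty ι] [CompleteSpace 𝕜]
    (hbdd : ∀ a : ℕ →₀ 𝕜, BddAbove (Set.range fun i => q i a))
    (hsep : ∀ a : ℕ →₀ 𝕜, (∀ i, q i a = 0) → a = 0)
    (htrunc : ∀ i M, ∃ j, ∀ a, q i ((Set.Iio M).indicator a) ≤ q j a) :
    ∃ (X : Type u) (_ : NormedAddCommGroup X) (_ : NormedSpace 𝕜 X) (_ : CompleteSpace X)
      (b : SchauderBasis 𝕜 X),
      ∀ a : ℕ →₀ 𝕜, ‖Finsupp.linearCombination 𝕜 b a‖ = ⨆ i, q i a := by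
  let p : Seminorm 𝕜 (ℕ →₀ 𝕜) := ⨆ i, (q i).comp Finsupp.lcoeFun
  have hp (a : ℕ →₀ 𝕜) : p a = ⨆ i, q i a :=
    Seminorm.iSup_apply (Seminorm.bddAbove_range_iff.mpr hbdd)
  have hle (i : ι) (a : ℕ →₀ 𝕜) : q i a ≤ p a := hp a ▸ le_ciSup (hbdd a) i
  have core : @NormedSpace.Core 𝕜 (ℕ →₀ 𝕜) _ _ _ ⟨p⟩ :=
    let : Norm (ℕ →₀ 𝕜) := ⟨p⟩
    { norm_nonneg := apply_nonneg p
      norm_smul := map_smul_eq_mul p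
      norm_triangle := map_add_le_add p
      norm_eq_zero_iff := fun a =>
        ⟨fun h => hsep a fun i => ((hle i a).trans h.le).antisymm (apply_nonneg _ _),
          fun h => h ▸ map_zero p⟩ }
  let : Norm (ℕ →₀ 𝕜) := ⟨p⟩
  let : NormedAddCommGroup (ℕ →₀ 𝕜) := NormedAddCommGroup.ofCore core
  let : NormedSpace 𝕜 (ℕ →₀ 𝕜) := NormedSpace.ofCore core
  let e (n : ℕ) : UniformSpace.Completion (ℕ →₀ 𝕜) := ↑(Finsupp.single n (1 : 𝕜))
  have he : Finsupp.linearCombination 𝕜 e =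
      (UniformSpace.Completion.toComplL : (ℕ →₀ 𝕜) →L[𝕜] _).toLinearMap := by
    ext n
    simp [e]
  have hnorm (a : ℕ →₀ 𝕜) : ‖Finsupp.linearCombination 𝕜 e a‖ = p a :=
    (congrArg norm (LinearMap.congr_fun he a)).trans (UniformSpace.Completion.norm_coe a)
  obtain ⟨b, hb⟩ := exists_schauderBasis_of_norm_filter_le (e := e) (C := 1)
    (fun n => by simp [e, UniformSpace.Completion.coe_eq_zero_iff])
    (by rw [he]; exact UniformSpace.Completion.denseRange_coe)
    (fun a M => by
      rw [hnorm, hnorm, one_mul, hp]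
      refine ciSup_le fun i => ?_
      obtain ⟨j, hj⟩ := htrunc i M
      rw [Finsupp.filter_eq_indicator]
      exact (hj a).trans (hle j a))
  exact ⟨_, _, _, inferInstance, b, fun a => by rw [hb, hnorm, hp]⟩

theorem proj_eq_linearCombination {X : Type*} [NormedAddCommGroup X] [NormedSpace 𝕜 X]
    (b : SchauderBasis 𝕜 X) (M : ℕ) (x : X) :
    ∃ a : ℕ →₀ 𝕜, ⇑a = (Set.Iio M).indicator (fun n => b.coord n x) ∧
      b.proj M x = Finsupp.linearCombination 𝕜 b a := by
  refine ⟨Finsupp.indicator (Finset.range M) fun n _ => b.coord n x, ?_, ?_⟩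
  · ext n
    simp [Finsupp.indicator_apply, Set.indicator_apply]
  · rw [SchauderBasis.proj_apply, Finsupp.linearCombination_apply,
      Finsupp.sum_of_support_subset _ (Finsupp.support_indicator_subset _ _) _ (by simp)]
    exact Finset.sum_congr rfl fun n hn => by rw [Finsupp.indicator_of_mem hn]

theorem exists_schauderBasis_isLUB_norm [Nonempty ι] [CompleteSpace 𝕜]
    (hcont : ∀ i, Continuous (q i))
    (hbdd : ∀ a : ℕ →₀ 𝕜, BddAbove (Set.range fun i => q i a))
    (hsep : ∀ a : ℕ →₀ 𝕜, (∀ i, q i a = 0) → a = 0)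
    (htrunc : ∀ i M, ∃ j, ∀ a, q i ((Set.Iio M).indicator a) ≤ q j a) :
    ∃ (X : Type u) (_ : NormedAddCommGroup X) (_ : NormedSpace 𝕜 X) (_ : CompleteSpace X)
      (b : SchauderBasis 𝕜 X),
      ∀ x : X, IsLUB (Set.range fun i => q i fun n => b.coord n x) ‖x‖ := by
  obtain ⟨X, _, _, _, b, hb⟩ := exists_norm_linearCombination_eq_iSup hbdd hsep htrunc
  refine ⟨X, _, _, ‹_›, b, fun x => ?_⟩
  have hproj (M : ℕ) : IsLUB
      (Set.range fun i => q i ((Set.Iio M).indicator fun n => b.coord n x)) ‖b.proj M x‖ := by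
    obtain ⟨a, ha, hMa⟩ := proj_eq_linearCombination b M x
    rw [hMa, hb, ← ha]
    exact isLUB_ciSup (hbdd a)
  have hlim := (b.tendsto_proj x).norm
  constructor
  · rintro _ ⟨i, rfl⟩
    have hcoord : Filter.Tendsto (fun M => (Set.Iio M).indicator fun n => b.coord n x) Filter.atTop
        (nhds fun n => b.coord n x) := tendsto_pi_nhds.mpr fun n =>
      tendsto_const_nhds.congr' <| (Filter.eventually_gt_atTop n).mono fun M hM =>
        (Set.indicator_of_mem (Set.mem_Iio.mpr hM) _).symm
    exact le_of_tendsto_of_tendsto' (((hcont i).tendsto _).comp hcoord) hlim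
      fun M => (hproj M).1 ⟨i, rfl⟩
  · intro K hK
    refine le_of_tendsto' hlim fun M => (hproj M).2 ?_
    rintro _ ⟨i, rfl⟩
    obtain ⟨j, hj⟩ := htrunc i M
    exact (hj _).trans (hK ⟨j, rfl⟩)

end Completion

/-! ### Primitive sequences of non-increasing weights -/

@[simp]
theorem primitiveSeq_zero (w : ℕ → ℝ) : primitiveSeq w 0 = 0 := by simp [primitiveSeq]

theorem primitiveSeq_succ (w : ℕ → ℝ) (m : ℕ) :
    primitiveSeq w (m + 1) = primitiveSeq w m + w (m + 1) :=
  Finset.sum_Icc_succ_top (by omega) _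

@[simp]
theorem primitiveSeq_one (w : ℕ → ℝ) : primitiveSeq w 1 = w 1 := by simp [primitiveSeq]

namespace IsNonincreasingWeight

variable {w : ℕ → ℝ}

theorem primitiveSeq_monotone (hw : IsNonincreasingWeight w) : Monotone (primitiveSeq w) :=
  monotone_nat_of_le_succ fun m => by
    rw [primitiveSeq_succ]
    linarith [hw.nonneg (m + 1) (by omega)]

theorem primitiveSeq_nonneg (hw : IsNonincreasingWeight w) (m : ℕ) : 0 ≤ primitiveSeq w m := by
  simpa using hw.primitiveSeq_monotone (Nat.zero_le m)

theorem primitiveSeq_pos (hw : IsNonincreasingWeight w) {m : ℕ} (hm : 1 ≤ m) :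
    0 < primitiveSeq w m := by
  have := hw.primitiveSeq_monotone hm
  rw [primitiveSeq_one] at this
  exact hw.pos_one.trans_le this

theorem card_mul_le_primitiveSeq (hw : IsNonincreasingWeight w) {m n : ℕ} (hmn : m ≤ n) :
    m * w n ≤ primitiveSeq w m := by
  induction m with
  | zero => simp
  | succ m ih =>
    rw [primitiveSeq_succ]
    have := ih (by omega)
    have := hw.nonincreasing (m + 1) n (by omega) hmn
    push_cast
    linarith

theorem le_primitiveSeq_div (hw : IsNonincreasingWeight w) {m n : ℕ} (hm : 1 ≤ m) (hmn : m ≤ n) :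
    w n ≤ primitiveSeq w m / m := by
  rw [le_div_iff₀' (by exact_mod_cast hm)]
  exact hw.card_mul_le_primitiveSeq hmn

theorem mul_primitiveSeq_le (hw : IsNonincreasingWeight w) {m n : ℕ} (hmn : m ≤ n) :
    m * primitiveSeq w n ≤ n * primitiveSeq w m := by
  induction n, hmn using Nat.le_induction with
  | base => rfl
  | succ n hmn ih =>
    rw [primitiveSeq_succ]
    have := hw.card_mul_le_primitiveSeq (m := m) (n := n + 1) (by omega)
    push_cast
    linarith

theorem dualSeq_primitiveSeq_monotone (hw : IsNonincreasingWeight w) :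
    Monotone (dualSeq (primitiveSeq w)) := fun m n hmn => by
  rcases Nat.eq_zero_or_pos m with rfl | hm
  · simpa [dualSeq] using div_nonneg n.cast_nonneg (hw.primitiveSeq_nonneg n)
  · rw [dualSeq, dualSeq, div_le_div_iff₀ (hw.primitiveSeq_pos hm)
      (hw.primitiveSeq_pos (hm.trans_le hmn))]
    exact hw.mul_primitiveSeq_le hmn

theorem primitiveSeq_div_le (hw : IsNonincreasingWeight w) {m n : ℕ} (hm : 1 ≤ m) (hmn : m ≤ n) :
    primitiveSeq w n / n ≤ primitiveSeq w m / m := by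
  have hm' : (0 : ℝ) < m := by exact_mod_cast hm
  have hn' : (0 : ℝ) < n := by exact_mod_cast hm.trans hmn
  rw [div_le_div_iff₀ hn' hm']
  linarith [hw.mul_primitiveSeq_le hmn]

theorem primitiveSeq_add_sub_le (hw : IsNonincreasingWeight w) {p m : ℕ} (hpm : p ≤ m) (l : ℕ) :
    primitiveSeq w (m + l) - primitiveSeq w m ≤ primitiveSeq w (p + l) - primitiveSeq w p := by
  induction l with
  | zero => simp
  | succ l ih =>
    rw [← add_assoc, ← add_assoc, primitiveSeq_succ, primitiveSeq_succ]
    linarith [hw.nonincreasing (p + l + 1) (m + l + 1) (by omega) (by omega)]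

theorem sum_shift_le (hw : IsNonincreasingWeight w) (m : ℕ) (E : Finset ℕ) :
    ∑ n ∈ E, w (m + n + 1) ≤ primitiveSeq w (m + E.card) - primitiveSeq w m := by
  induction E using Finset.induction_on_max with
  | empty => simp
  | insert q E hq ih =>
    have hqE : q ∉ E := fun h => lt_irrefl _ (hq q h)
    have hcard : E.card ≤ q := by
      simpa using Finset.card_le_card (fun x hx => Finset.mem_range.mpr (hq x hx) :
        E ⊆ Finset.range q)
    rw [Finset.sum_insert hqE, Finset.card_insert_of_notMem hqE, ← add_assoc, primitiveSeq_succ]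
    linarith [hw.nonincreasing (m + E.card + 1) (m + q + 1) (by omega) (by omega)]

end IsNonincreasingWeight

/-! ### The norming seminorms -/

section NormingSeminorm

variable {𝕜 : Type*} [RCLike 𝕜] {w : ℕ → ℝ} (hw : IsNonincreasingWeight w)

/-- The seminorms whose supremum is the norm of the space. The first summand is the symmetric norm
of a Marcinkiewicz space tested on `B`; the second one, which is only sensitive to partial sums,
is responsible for conditionality, and the shift of its weight by `|B|` is what keeps
Property (A). -/
noncomputable def normingSeminorm (B : Finset ℕ) (N : ℕ) : Seminorm 𝕜 (ℕ → 𝕜) :=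
  Seminorm.of
    (fun a => primitiveSeq w B.card / B.card * ∑ n ∈ B, ‖a n‖ +
      1 / 2 * ‖∑ n ∈ Finset.range N \ B, (w (B.card + n + 1) : 𝕜) * a n‖)
    (fun a a' => by
      have hsymm : ∑ n ∈ B, ‖(a + a') n‖ ≤ ∑ n ∈ B, ‖a n‖ + ∑ n ∈ B, ‖a' n‖ := by
        rw [← Finset.sum_add_distrib]
        exact Finset.sum_le_sum fun n _ => norm_add_le _ _
      have hcond := norm_add_le (∑ n ∈ Finset.range N \ B, (w (B.card + n + 1) : 𝕜) * a n)
        (∑ n ∈ Finset.range N \ B, (w (B.card + n + 1) : 𝕜) * a' n)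
      simp only [← Finset.sum_add_distrib, ← mul_add] at hcond
      have := mul_le_mul_of_nonneg_left hsymm
        (div_nonneg (hw.primitiveSeq_nonneg B.card) B.card.cast_nonneg)
      simp only [Pi.add_apply] at this ⊢
      linarith)
    (fun c a => by
      simp only [Pi.smul_apply, smul_eq_mul, mul_left_comm _ c, norm_mul, ← Finset.mul_sum]
      ring)

theorem normingSeminorm_apply (B : Finset ℕ) (N : ℕ) (a : ℕ → 𝕜) :
    normingSeminorm hw B N a = primitiveSeq w B.card / B.card * ∑ n ∈ B, ‖a n‖ +
      1 / 2 * ‖∑ n ∈ Finset.range N \ B, (w (B.card + n + 1) : 𝕜) * a n‖ :=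
  rfl

theorem continuous_normingSeminorm (B : Finset ℕ) (N : ℕ) :
    Continuous (normingSeminorm (𝕜 := 𝕜) hw B N) := by
  simp only [funext (normingSeminorm_apply hw B N)]
  fun_prop

theorem normingSeminorm_zero_right (B : Finset ℕ) (a : ℕ → 𝕜) :
    normingSeminorm hw B 0 a = primitiveSeq w B.card / B.card * ∑ n ∈ B, ‖a n‖ := by
  simp [normingSeminorm_apply]

theorem normingSeminorm_indicator_le (B : Finset ℕ) (N M : ℕ) (a : ℕ → 𝕜) :
    normingSeminorm hw B N ((Set.Iio M).indicator a) ≤ normingSeminorm hw B (min N M) a := by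
  have hsymm : ∑ n ∈ B, ‖(Set.Iio M).indicator a n‖ ≤ ∑ n ∈ B, ‖a n‖ :=
    Finset.sum_le_sum fun n _ => norm_indicator_le_norm_self _ _
  have hcond : ∑ n ∈ Finset.range N \ B, (w (B.card + n + 1) : 𝕜) * (Set.Iio M).indicator a n =
      ∑ n ∈ Finset.range (min N M) \ B, (w (B.card + n + 1) : 𝕜) * a n := by
    simp only [Set.indicator_apply, Set.mem_Iio, mul_ite, mul_zero, ← Finset.sum_filter]
    congr 1
    grind
  rw [normingSeminorm_apply, normingSeminorm_apply, hcond]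
  gcongr
  exact div_nonneg (hw.primitiveSeq_nonneg _) B.card.cast_nonneg

/-- The weight that `normingSeminorm hw B N` puts on the `n`-th coordinate, up to the factor `1/2`
outside `B`. -/
noncomputable def normingCoeff (w : ℕ → ℝ) (B : Finset ℕ) (n : ℕ) : ℝ :=
  if n ∈ B then primitiveSeq w B.card / B.card else w (B.card + n + 1)

theorem normingCoeff_of_mem (w : ℕ → ℝ) {B : Finset ℕ} {n : ℕ} (hn : n ∈ B) :
    normingCoeff w B n = primitiveSeq w B.card / B.card :=
  if_pos hn

theorem normingCoeff_of_notMem (w : ℕ → ℝ) {B : Finset ℕ} {n : ℕ} (hn : n ∉ B) :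
    normingCoeff w B n = w (B.card + n + 1) :=
  if_neg hn

include hw in
theorem normingCoeff_nonneg (B : Finset ℕ) (n : ℕ) : 0 ≤ normingCoeff w B n := by
  unfold normingCoeff
  split_ifs
  · exact div_nonneg (hw.primitiveSeq_nonneg _) B.card.cast_nonneg
  · exact hw.nonneg _ (by omega)

include hw in
theorem sum_normingCoeff_le (B A : Finset ℕ) :
    ∑ n ∈ A, normingCoeff w B n ≤ primitiveSeq w A.card := by
  have hle := Finset.card_le_card (Finset.inter_subset_right : A ∩ B ⊆ B)
  have hin : ∑ n ∈ A ∩ B, normingCoeff w B n ≤ primitiveSeq w (A ∩ B).card := by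
    rw [Finset.sum_congr rfl fun n hn => normingCoeff_of_mem w (Finset.mem_inter.mp hn).2,
      Finset.sum_const, nsmul_eq_mul]
    rcases Nat.eq_zero_or_pos B.card with h0 | hpos
    · simp [h0, hw.primitiveSeq_nonneg]
    · rw [← mul_div_assoc, div_le_iff₀ (by exact_mod_cast hpos)]
      linarith [hw.mul_primitiveSeq_le hle]
  have hout : ∑ n ∈ A \ B, normingCoeff w B n ≤
      primitiveSeq w A.card - primitiveSeq w (A ∩ B).card := by
    rw [Finset.sum_congr rfl fun n hn => normingCoeff_of_notMem w (Finset.mem_sdiff.mp hn).2]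
    conv_rhs => rw [← Finset.card_inter_add_card_sdiff A B]
    exact (hw.sum_shift_le B.card _).trans (hw.primitiveSeq_add_sub_le hle _)
  linarith [Finset.sum_inter_add_sum_sdiff A B (normingCoeff w B)]

theorem normingSeminorm_le_sum {a : ℕ → 𝕜} {A : Finset ℕ} (ha : ∀ n ∉ A, a n = 0)
    (B : Finset ℕ) (N : ℕ) :
    normingSeminorm hw B N a ≤ ∑ n ∈ A, normingCoeff w B n * ‖a n‖ := by
  have hnonneg (n : ℕ) : 0 ≤ normingCoeff w B n * ‖a n‖ :=
    mul_nonneg (normingCoeff_nonneg hw B n) (norm_nonneg _)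
  have hsymm : primitiveSeq w B.card / B.card * ∑ n ∈ B, ‖a n‖ =
      ∑ n ∈ B, normingCoeff w B n * ‖a n‖ := by
    rw [Finset.mul_sum]
    exact Finset.sum_congr rfl fun n hn => by rw [normingCoeff_of_mem w hn]
  have hcond : ‖∑ n ∈ Finset.range N \ B, (w (B.card + n + 1) : 𝕜) * a n‖ ≤
      ∑ n ∈ Finset.range N \ B, normingCoeff w B n * ‖a n‖ :=
    norm_sum_le_of_le _ fun n hn => by
      rw [normingCoeff_of_notMem w (Finset.mem_sdiff.mp hn).2, norm_mul,
        RCLike.norm_ofReal, abs_of_nonneg (hw.nonneg _ (by omega))]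
  calc normingSeminorm hw B N a
      ≤ ∑ n ∈ B, normingCoeff w B n * ‖a n‖ +
          ∑ n ∈ Finset.range N \ B, normingCoeff w B n * ‖a n‖ := by
        rw [normingSeminorm_apply]
        linarith [norm_nonneg (∑ n ∈ Finset.range N \ B, (w (B.card + n + 1) : 𝕜) * a n)]
    _ = ∑ n ∈ B ∪ (Finset.range N \ B), normingCoeff w B n * ‖a n‖ :=
        (Finset.sum_union Finset.disjoint_sdiff).symm
    _ ≤ ∑ n ∈ (B ∪ (Finset.range N \ B)) ∪ A, normingCoeff w B n * ‖a n‖ :=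
        Finset.sum_le_sum_of_subset_of_nonneg Finset.subset_union_left fun n _ _ => hnonneg n
    _ = ∑ n ∈ A, normingCoeff w B n * ‖a n‖ :=
        (Finset.sum_subset Finset.subset_union_right fun n _ hn => by simp [ha n hn]).symm

end NormingSeminorm

section IsNormedBy

/-- The norm of `X` is the supremum of the norming seminorms of the coordinates. -/
def IsNormedBy {𝕜 X : Type*} [RCLike 𝕜] [NormedAddCommGroup X] [NormedSpace 𝕜 X]
    (b : SchauderBasis 𝕜 X) {w : ℕ → ℝ} (hw : IsNonincreasingWeight w) : Prop :=
  ∀ x : X, IsLUB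
    (Set.range fun i : Finset ℕ × ℕ => normingSeminorm hw i.1 i.2 fun n => b.coord n x) ‖x‖

theorem exists_isNormedBy (𝕜 : Type u) [RCLike 𝕜] {w : ℕ → ℝ} (hw : IsNonincreasingWeight w) :
    ∃ (X : Type u) (_ : NormedAddCommGroup X) (_ : NormedSpace 𝕜 X) (_ : CompleteSpace X)
      (b : SchauderBasis 𝕜 X), IsNormedBy b hw := by
  refine exists_schauderBasis_isLUB_norm
    (q := fun i : Finset ℕ × ℕ => normingSeminorm (𝕜 := 𝕜) hw i.1 i.2)
    (fun i => continuous_normingSeminorm hw i.1 i.2) (fun a => ?_) (fun a ha => ?_)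
    (fun i M => ⟨(i.1, min i.2 M), normingSeminorm_indicator_le hw i.1 i.2 M⟩)
  · refine ⟨∑ n ∈ a.support, w 1 * ‖a n‖, Set.forall_mem_range.mpr fun i => ?_⟩
    have hcoeff (n : ℕ) : normingCoeff w i.1 n ≤ w 1 := by
      simpa using sum_normingCoeff_le hw i.1 {n}
    exact (normingSeminorm_le_sum hw (fun n hn => Finsupp.notMem_support_iff.mp hn) i.1 i.2).trans
      (Finset.sum_le_sum fun n _ => mul_le_mul_of_nonneg_right (hcoeff n) (norm_nonneg _))
  · ext n
    have h : normingSeminorm hw {n} 0 a = 0 := ha ({n}, 0)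
    simpa [normingSeminorm_zero_right, hw.pos_one.ne'] using h

variable {𝕜 X : Type*} [RCLike 𝕜] [NormedAddCommGroup X] [NormedSpace 𝕜 X]
  {b : SchauderBasis 𝕜 X} {w : ℕ → ℝ} {hw : IsNonincreasingWeight w}

theorem IsNormedBy.normingSeminorm_le (hb : IsNormedBy b hw) (x : X) (B : Finset ℕ) (N : ℕ) :
    normingSeminorm hw B N (fun n => b.coord n x) ≤ ‖x‖ :=
  (hb x).1 ⟨(B, N), rfl⟩

theorem IsNormedBy.norm_le (hb : IsNormedBy b hw) {x : X} {K : ℝ}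
    (h : ∀ B N, normingSeminorm hw B N (fun n => b.coord n x) ≤ K) : ‖x‖ ≤ K :=
  (hb x).2 (Set.forall_mem_range.mpr fun i => h i.1 i.2)

end IsNormedBy

/-! ### Democracy functions -/

section FundamentalFunction

variable {𝕜 X : Type*} [RCLike 𝕜] [NormedAddCommGroup X] [NormedSpace 𝕜 X]

theorem coord_sum_smul_basis (b : SchauderBasis 𝕜 X) (A : Finset ℕ) (c : ℕ → 𝕜) (k : ℕ) :
    b.coord k (∑ n ∈ A, c n • b n) = if k ∈ A then c k else 0 := by
  simp [b.ortho, Pi.single_apply]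

variable {b : SchauderBasis 𝕜 X} {w : ℕ → ℝ} {hw : IsNonincreasingWeight w}

namespace IsNormedBy

theorem norm_sum_smul_le (hb : IsNormedBy b hw) {A : Finset ℕ} {ε : ℕ → 𝕜}
    (hε : ∀ n ∈ A, ‖ε n‖ = 1) : ‖∑ n ∈ A, ε n • b n‖ ≤ primitiveSeq w A.card := by
  refine hb.norm_le fun B N => ?_
  simp only [coord_sum_smul_basis]
  refine (normingSeminorm_le_sum hw (A := A) (fun n hn => if_neg hn) B N).trans ?_
  refine le_of_eq_of_le (Finset.sum_congr rfl fun n hn => ?_) (sum_normingCoeff_le hw B A)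
  rw [if_pos hn, hε n hn, mul_one]

theorem primitiveSeq_div_mul_sum_norm_coord_le (hb : IsNormedBy b hw) (x : X) (A : Finset ℕ) :
    primitiveSeq w A.card / A.card * ∑ n ∈ A, ‖b.coord n x‖ ≤ ‖x‖ :=
  (normingSeminorm_zero_right hw A _).symm.trans_le (hb.normingSeminorm_le x A 0)

theorem fundamentalFunction_eq (hb : IsNormedBy b hw) (m : ℕ) :
    fundamentalFunction 𝕜 b.basis m = ENNReal.ofReal (primitiveSeq w m) := by
  apply le_antisymm
  · refine iSup₂_le fun A hA => iSup₂_le fun ε hε => ?_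
    rw [← ofReal_norm]
    exact ENNReal.ofReal_le_ofReal
      ((hb.norm_sum_smul_le hε).trans (hw.primitiveSeq_monotone hA))
  · refine le_trans ?_ (le_iSup₂_of_le (Finset.range m) (by simp)
      (le_iSup₂_of_le (fun _ => (1 : 𝕜)) (by simp) le_rfl))
    rw [← ofReal_norm]
    refine ENNReal.ofReal_le_ofReal (le_of_eq_of_le ?_
      (hb.primitiveSeq_div_mul_sum_norm_coord_le _ (Finset.range m)))
    simp only [coord_sum_smul_basis]
    rw [Finset.sum_congr rfl fun n hn => by rw [if_pos hn, norm_one]]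
    rcases eq_or_ne m 0 with rfl | hm
    · simp
    · simp [hm]

theorem fundamentalFunction_seqEquiv (hb : IsNormedBy b hw) {s : ℕ → ℝ}
    (hs : SeqEquiv (primitiveSeq w) s) :
    ENNSeqEquiv (fundamentalFunction 𝕜 b.basis) fun m => ENNReal.ofReal (s m) := by
  obtain ⟨C, hC, h⟩ := hs
  refine ⟨C.toNNReal, fun m hm => ?_⟩
  rw [hb.fundamentalFunction_eq, ENNReal.coe_nnreal_eq, Real.coe_toNNReal _ hC.le,
    ← ENNReal.ofReal_mul hC.le, ← ENNReal.ofReal_mul hC.le]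
  exact (h m hm).imp ENNReal.ofReal_le_ofReal ENNReal.ofReal_le_ofReal

theorem sum_norm_coord_le (hb : IsNormedBy b hw) (x : X) (A : Finset ℕ) :
    ∑ n ∈ A, ‖b.coord n x‖ ≤ dualSeq (primitiveSeq w) A.card * ‖x‖ := by
  rcases A.eq_empty_or_nonempty with rfl | hA
  · simp [dualSeq]
  · have hpos : (0 : ℝ) < primitiveSeq w A.card / A.card :=
      div_pos (hw.primitiveSeq_pos hA.card_pos) (by exact_mod_cast hA.card_pos)
    rw [dualSeq, ← inv_div, inv_mul_eq_div, le_div_iff₀' hpos]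
    exact hb.primitiveSeq_div_mul_sum_norm_coord_le x A

theorem fundamentalFunction_coord_le (hb : IsNormedBy b hw) (m : ℕ) :
    fundamentalFunction 𝕜 b.coord m ≤ ENNReal.ofReal (dualSeq (primitiveSeq w) m) := by
  refine iSup₂_le fun A hA => iSup₂_le fun ε hε => ?_
  rw [← ofReal_norm]
  refine ENNReal.ofReal_le_ofReal (ContinuousLinearMap.opNorm_le_bound _
    (div_nonneg m.cast_nonneg (hw.primitiveSeq_nonneg m)) fun x => ?_)
  calc ‖(∑ n ∈ A, ε n • b.coord n) x‖
      ≤ ∑ n ∈ A, ‖b.coord n x‖ := by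
        rw [sum_apply]
        exact norm_sum_le_of_le _ fun n hn => by simp [hε n hn]
    _ ≤ dualSeq (primitiveSeq w) A.card * ‖x‖ := hb.sum_norm_coord_le x A
    _ ≤ dualSeq (primitiveSeq w) m * ‖x‖ := by gcongr; exact hw.dualSeq_primitiveSeq_monotone hA

theorem isBidemocratic (hb : IsNormedBy b hw) : IsBidemocratic b := by
  refine ⟨1, fun m hm => ?_⟩
  have hpos := hw.primitiveSeq_pos hm
  rw [hb.fundamentalFunction_eq]
  refine (mul_le_mul_right (hb.fundamentalFunction_coord_le m) _).trans ?_
  rw [← ENNReal.ofReal_mul hpos.le, dualSeq, mul_div_cancel₀ _ hpos.ne']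
  simp

end IsNormedBy

end FundamentalFunction

/-! ### Property (A) -/

theorem sum_sub_succ_le_of_antitone {v : ℕ → ℝ} (hv : Antitone v) (hv0 : ∀ n, 0 ≤ v n)
    (E : Finset ℕ) : ∑ n ∈ E, (v n - v (n + 1)) ≤ v 0 := by
  obtain ⟨N, hN⟩ := E.exists_nat_subset_range
  calc ∑ n ∈ E, (v n - v (n + 1))
      ≤ ∑ n ∈ Finset.range N, (v n - v (n + 1)) :=
        Finset.sum_le_sum_of_subset_of_nonneg hN fun n _ _ => sub_nonneg.mpr (hv n.le_succ)
    _ = v 0 - v N := Finset.sum_range_sub' v N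
    _ ≤ v 0 := sub_le_self _ (hv0 N)

theorem norm_sum_le_norm_sum_erase_add {ι E : Type*} [DecidableEq ι] [SeminormedAddCommGroup E]
    (s : Finset ι) (q : ι) (f : ι → E) :
    ‖∑ n ∈ s, f n‖ ≤ ‖∑ n ∈ s.erase q, f n‖ + ‖f q‖ := by
  by_cases hq : q ∈ s
  · rw [← Finset.sum_erase_add s f hq]
    exact norm_add_le _ _
  · rw [Finset.erase_eq_of_notMem hq]
    exact le_add_of_nonneg_right (norm_nonneg _)

theorem exists_forall_norm_le_of_tendsto_zero {E : Type*} [NormedAddCommGroup E] {f : ℕ → E}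
    (hf : Filter.Tendsto f Filter.atTop (nhds 0)) : ∃ q, ∀ n, ‖f n‖ ≤ ‖f q‖ := by
  by_cases h0 : ∀ n, f n = 0
  · exact ⟨0, fun n => by simp [h0]⟩
  · obtain ⟨k, hk⟩ := not_forall.mp h0
    refine (continuous_of_discreteTopology (f := fun n => ‖f n‖)).exists_forall_ge' k ?_
    rw [Filter.cocompact_eq_cofinite, Nat.cofinite_eq_atTop]
    exact (hf.norm.eventually_lt_const (norm_zero.trans_lt (norm_pos_iff.mpr hk))).mono
      fun _ => le_of_lt

namespace IsNonincreasingWeight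

variable {w : ℕ → ℝ}

theorem antitone_shift (hw : IsNonincreasingWeight w) (m : ℕ) : Antitone fun n => w (m + n + 1) :=
  fun n n' h => hw.nonincreasing _ _ (by omega) (by omega)

theorem primitiveSeq_div_mul_add_le (hw : IsNonincreasingWeight w) {m : ℕ} {S t : ℝ}
    (hS0 : 0 ≤ S) (hS : S ≤ m * t) :
    primitiveSeq w m / m * S + w (m + 1) * t ≤
      primitiveSeq w (m + 1) / (m + 1 : ℕ) * (S + t) := by
  rcases Nat.eq_zero_or_pos m with rfl | hm
  · obtain rfl : S = 0 := le_antisymm (by simpa using hS) hS0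
    simp
  have : (0 : ℝ) < m := Nat.cast_pos.mpr hm
  have hslope : 0 ≤ primitiveSeq w m / m - primitiveSeq w (m + 1) / (m + 1 : ℕ) :=
    sub_nonneg.mpr (hw.primitiveSeq_div_le hm m.le_succ)
  calc primitiveSeq w m / m * S + w (m + 1) * t
      = primitiveSeq w (m + 1) / (m + 1 : ℕ) * (S + t) -
          (primitiveSeq w m / m - primitiveSeq w (m + 1) / (m + 1 : ℕ)) * (m * t - S) := by
        rw [primitiveSeq_succ]
        push_cast
        field_simp
        ring
    _ ≤ primitiveSeq w (m + 1) / (m + 1 : ℕ) * (S + t) :=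
        sub_le_self _ (mul_nonneg hslope (sub_nonneg.mpr hS))

end IsNonincreasingWeight

section Relocation

variable {𝕜 : Type*} [RCLike 𝕜] {w : ℕ → ℝ} (hw : IsNonincreasingWeight w) {a : ℕ → 𝕜} {t : ℝ}

theorem norm_sum_mul_sub_sum_mul_succ_le {v : ℕ → ℝ} (hv : Antitone v) (hv0 : ∀ n, 0 ≤ v n)
    (ha : ∀ n, ‖a n‖ ≤ t) (E : Finset ℕ) :
    ‖∑ n ∈ E, (v n : 𝕜) * a n - ∑ n ∈ E, (v (n + 1) : 𝕜) * a n‖ ≤ v 0 * t := by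
  rw [← Finset.sum_sub_distrib]
  calc ‖∑ n ∈ E, ((v n : 𝕜) * a n - (v (n + 1) : 𝕜) * a n)‖
      ≤ ∑ n ∈ E, (v n - v (n + 1)) * t := norm_sum_le_of_le _ fun n _ => by
        have hstep := sub_nonneg.mpr (hv n.le_succ)
        rw [← sub_mul, ← RCLike.ofReal_sub, norm_mul, RCLike.norm_ofReal, abs_of_nonneg hstep]
        exact mul_le_mul_of_nonneg_left (ha n) hstep
    _ ≤ v 0 * t := by
        rw [← Finset.sum_mul]
        exact mul_le_mul_of_nonneg_right (sum_sub_succ_le_of_antitone hv hv0 E)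
          ((norm_nonneg _).trans (ha 0))

theorem normingSeminorm_le_insert (ha : ∀ n, ‖a n‖ ≤ t) {B : Finset ℕ} {q : ℕ} (hq : q ∉ B)
    (hqt : ‖a q‖ = t) (N : ℕ) :
    normingSeminorm hw B N a ≤ normingSeminorm hw (insert q B) N a := by
  set v : ℕ → ℝ := fun n => w (B.card + n + 1)
  have hv : Antitone v := hw.antitone_shift B.card
  have hv0 (n : ℕ) : 0 ≤ v n := hw.nonneg _ (by omega)
  have ht : 0 ≤ t := hqt ▸ norm_nonneg _
  have hsymm : primitiveSeq w B.card / B.card * ∑ n ∈ B, ‖a n‖ + v 0 * t ≤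
      primitiveSeq w (B.card + 1) / (B.card + 1 : ℕ) * (∑ n ∈ B, ‖a n‖ + t) :=
    hw.primitiveSeq_div_mul_add_le (Finset.sum_nonneg fun _ _ => norm_nonneg _)
      (by simpa using Finset.sum_le_card_nsmul B _ t fun n _ => ha n)
  have hshift := norm_sum_mul_sub_sum_mul_succ_le hv hv0 ha (Finset.range N \ B)
  have herase := norm_sum_le_norm_sum_erase_add (Finset.range N \ B) q
    fun n => (v (n + 1) : 𝕜) * a n
  have hterm : ‖(v (q + 1) : 𝕜) * a q‖ ≤ v 0 * t := by
    rw [norm_mul, RCLike.norm_ofReal, abs_of_nonneg (hv0 _), hqt]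
    exact mul_le_mul_of_nonneg_right (hv q.succ.zero_le) ht
  have hv_succ (n : ℕ) : w (B.card + 1 + n + 1) = v (n + 1) := congrArg w (by omega)
  rw [normingSeminorm_apply, normingSeminorm_apply, Finset.card_insert_of_notMem hq,
    Finset.sum_insert hq, hqt, Finset.sdiff_insert, add_comm t]
  simp only [hv_succ]
  linarith [norm_sub_norm_le (∑ n ∈ Finset.range N \ B, (v n : 𝕜) * a n)
    (∑ n ∈ Finset.range N \ B, (v (n + 1) : 𝕜) * a n)]

theorem normingSeminorm_le_union (ha : ∀ n, ‖a n‖ ≤ t) (B : Finset ℕ) {A : Finset ℕ}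
    (hA : ∀ q ∈ A, ‖a q‖ = t) (N : ℕ) :
    normingSeminorm hw B N a ≤ normingSeminorm hw (A ∪ B) N a := by
  induction A using Finset.induction_on with
  | empty => simp
  | insert q A _ ih =>
    refine (ih fun n hn => hA n (Finset.mem_insert_of_mem hn)).trans ?_
    rw [Finset.insert_union]
    by_cases hqB : q ∈ A ∪ B
    · rw [Finset.insert_eq_of_mem hqB]
    · exact normingSeminorm_le_insert hw ha hqB (hA q (Finset.mem_insert_self _ _)) N

theorem normingSeminorm_map {a' : ℕ → 𝕜} {π : Equiv.Perm ℕ} {B : Finset ℕ}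
    (hnorm : ∀ n, ‖a' (π n)‖ = ‖a n‖) (hfix : ∀ n ∉ B, a n ≠ 0 → π n = n ∧ a' n = a n) (N : ℕ) :
    normingSeminorm hw (B.map π.toEmbedding) N a' = normingSeminorm hw B N a := by
  have hout (n : ℕ) : (if n ∈ B.map π.toEmbedding then 0 else a' n) = if n ∈ B then 0 else a n := by
    obtain ⟨k, rfl⟩ := π.surjective n
    simp only [Finset.mem_map_equiv, Equiv.symm_apply_apply]
    by_cases hmoved : k ∉ B ∧ a k ≠ 0
    · obtain ⟨hπ, ha'⟩ := hfix k hmoved.1 hmoved.2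
      rw [hπ, ha']
    · have hleft : (if k ∈ B then 0 else a' (π k)) = 0 := by
        rw [ite_eq_left_iff, ← norm_eq_zero, hnorm, norm_eq_zero]
        tauto
      rw [hleft, eq_comm, ite_eq_left_iff]
      intro hπk
      by_contra h0
      have hk := π.injective (hfix _ hπk h0).1
      rw [hk] at hπk h0
      exact hmoved ⟨hπk, h0⟩
  have hsum (E : Finset ℕ) (c a : ℕ → 𝕜) : ∑ n ∈ Finset.range N \ E, c n * a n =
      ∑ n ∈ Finset.range N, c n * if n ∈ E then 0 else a n := by
    rw [Finset.sdiff_eq_filter, Finset.sum_filter]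
    exact Finset.sum_congr rfl fun n _ => by by_cases h : n ∈ E <;> simp [h]
  rw [normingSeminorm_apply, normingSeminorm_apply, Finset.card_map, Finset.sum_map,
    hsum, hsum B]
  simp only [hout, Equiv.coe_toEmbedding, hnorm]

end Relocation

section PropertyA

variable {𝕜 X : Type*} [RCLike 𝕜] [NormedAddCommGroup X] [NormedSpace 𝕜 X]
  {b : SchauderBasis 𝕜 X} {w : ℕ → ℝ} {hw : IsNonincreasingWeight w}

theorem tendsto_coord_smul_basis (b : SchauderBasis 𝕜 X) (x : X) :
    Filter.Tendsto (fun n => b.coord n x • b n) Filter.atTop (nhds 0) := by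
  have h := b.tendsto_proj x
  have hdiff := ((Filter.tendsto_add_atTop_iff_nat 1).mpr h).sub h
  rw [sub_self] at hdiff
  refine hdiff.congr fun n => ?_
  rw [SchauderBasis.proj_apply, SchauderBasis.proj_apply, Finset.sum_range_succ,
    add_sub_cancel_left]

theorem IsNormedBy.le_norm_basis (hb : IsNormedBy b hw) (n : ℕ) : w 1 ≤ ‖b n‖ := by
  simpa [b.ortho] using hb.primitiveSeq_div_mul_sum_norm_coord_le (b n) {n}

theorem IsNormedBy.tendsto_coord (hb : IsNormedBy b hw) (x : X) :
    Filter.Tendsto (fun n => b.coord n x) Filter.atTop (nhds 0) := by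
  have h := ((tendsto_coord_smul_basis b x).norm).div_const (w 1)
  rw [norm_zero, zero_div] at h
  refine squeeze_zero_norm (fun n => ?_) h
  rw [le_div_iff₀ hw.pos_one, norm_smul]
  exact mul_le_mul_of_nonneg_left (hb.le_norm_basis n) (norm_nonneg _)

theorem IsGreedyRearrangement.symm {x y : X} (h : IsGreedyRearrangement b x y) :
    IsGreedyRearrangement b y x := by
  obtain ⟨π, hnorm, hfix⟩ := h
  have hnorm' (n : ℕ) : ‖b.coord (π.symm n) x‖ = ‖b.coord n y‖ := by
    rw [← hnorm, Equiv.apply_symm_apply]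
  refine ⟨π.symm, hnorm', fun k hk ⟨n, hn⟩ => ?_⟩
  have hk' : b.coord (π.symm k) x ≠ 0 := by rwa [← norm_ne_zero_iff, hnorm', norm_ne_zero_iff]
  obtain ⟨hπ, hcoord⟩ := hfix _ hk' ⟨π.symm n, by rwa [hnorm', hnorm']⟩
  rw [Equiv.apply_symm_apply] at hπ
  rw [← hπ] at hcoord
  exact ⟨hπ.symm, hcoord.symm⟩

theorem IsNormedBy.norm_le_of_isGreedyRearrangement (hb : IsNormedBy b hw) {x y : X}
    (h : IsGreedyRearrangement b x y) : ‖x‖ ≤ ‖y‖ := by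
  obtain ⟨π, hnorm, hfix⟩ := h
  obtain ⟨q, hq⟩ := exists_forall_norm_le_of_tendsto_zero (hb.tendsto_coord x)
  rcases eq_or_ne (b.coord q x) 0 with h0 | h0
  · have hx (n : ℕ) : b.coord n x = 0 := by simpa [h0] using hq n
    exact hb.norm_le fun B N => by simp [normingSeminorm_apply, hx]
  have hfin : {n | ‖b.coord n x‖ = ‖b.coord q x‖}.Finite := by
    have hlt := (hb.tendsto_coord x).norm.eventually_lt_const
      (norm_zero.trans_lt (norm_pos_iff.mpr h0))
    rw [← Nat.cofinite_eq_atTop, Filter.eventually_cofinite] at hlt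
    exact hlt.subset fun n hn => not_lt.mpr (Eq.ge hn)
  refine hb.norm_le fun B N => ?_
  calc normingSeminorm hw B N (fun n => b.coord n x)
      ≤ normingSeminorm hw (hfin.toFinset ∪ B) N (fun n => b.coord n x) :=
        normingSeminorm_le_union hw hq B (by simp) N
    _ = normingSeminorm hw ((hfin.toFinset ∪ B).map π.toEmbedding) N (fun n => b.coord n y) := by
        refine (normingSeminorm_map hw hnorm (fun n hn hn0 => ?_) N).symm
        refine hfix n hn0 ⟨q, (hq n).lt_of_ne fun hmax => hn ?_⟩
        exact Finset.mem_union_left _ (hfin.mem_toFinset.mpr hmax)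
    _ ≤ ‖y‖ := hb.normingSeminorm_le y _ N

theorem IsNormedBy.hasPropertyA (hb : IsNormedBy b hw) : HasPropertyA b := fun _ _ h =>
  (hb.norm_le_of_isGreedyRearrangement h).antisymm (hb.norm_le_of_isGreedyRearrangement h.symm)

end PropertyA

/-! ### The unconditionality parameters: upper bound -/

theorem uncondParamTilde_le_uncondParam {𝕜 X : Type*} [RCLike 𝕜] [NormedAddCommGroup X]
    [NormedSpace 𝕜 X] (b : SchauderBasis 𝕜 X) (m : ℕ) :
    uncondParamTilde b m ≤ uncondParam b m := by
  refine iSup₂_le fun A f => iSup₂_le fun hf hm => ?_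
  have hcard : (A ∩ Finset.range m).card ≤ m := by
    simpa using Finset.card_le_card (Finset.inter_subset_right : A ∩ Finset.range m ⊆ _)
  have hproj : GeneralSchauderBasis.proj b A f =
      GeneralSchauderBasis.proj b (A ∩ Finset.range m) f := by
    rw [GeneralSchauderBasis.proj_apply, GeneralSchauderBasis.proj_apply]
    refine (Finset.sum_subset Finset.inter_subset_left fun n hn hn' => ?_).symm
    rw [hm n (by simpa [hn] using hn'), zero_smul]
  refine le_iSup₂_of_le (A ∩ Finset.range m) hcard ?_
  rw [hproj, ← ofReal_norm, ← ofReal_norm]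
  exact ENNReal.ofReal_le_ofReal (ContinuousLinearMap.unit_le_opNorm _ f hf)

-- The term with `τ` keeps track of the part of the weight budget which `h` has not used yet, so
-- that removing the smallest value of `a` on `A` closes the induction (Abel summation).
theorem sum_mul_add_le_primitiveSeq {ι : Type*} {w d : ℕ → ℝ} {h a : ι → ℝ}
    (hh : ∀ A : Finset ι, ∑ n ∈ A, h n ≤ primitiveSeq w A.card)
    (ha : ∀ (A : Finset ι) (τ : ℝ), A.Nonempty → (∀ n ∈ A, τ ≤ a n) → w A.card * τ ≤ d A.card)
    (A : Finset ι) {τ : ℝ} (hτ : ∀ n ∈ A, τ ≤ a n) :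
    ∑ n ∈ A, h n * a n + (primitiveSeq w A.card - ∑ n ∈ A, h n) * τ ≤ primitiveSeq d A.card := by
  classical
  induction hA : A.card generalizing A τ with
  | zero => simp [Finset.card_eq_zero.mp hA]
  | succ j ih =>
    have hne : A.Nonempty := Finset.card_pos.mp (by omega)
    obtain ⟨q, hq, hmin⟩ := A.exists_min_image a hne
    have herase := ih (A.erase q) (fun n hn => hmin n (Finset.mem_of_mem_erase hn))
      (by rw [Finset.card_erase_of_mem hq, hA, Nat.add_sub_cancel])
    have hlast := ha A (a q) hne hmin
    have hbudget := mul_le_mul_of_nonneg_left (hτ q hq) (sub_nonneg.mpr (hh A))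
    rw [hA] at hlast hbudget
    have hsum := Finset.add_sum_erase A (fun n => h n * a n) hq
    have hsum' := Finset.add_sum_erase A h hq
    rw [primitiveSeq_succ, ← hsum'] at hbudget ⊢
    rw [primitiveSeq_succ, ← hsum]
    linarith

theorem harmonic_mono : Monotone harmonic := monotone_nat_of_le_succ fun n => by
  rw [harmonic_succ]
  exact le_add_of_nonneg_right (by positivity)

theorem harmonic_le_three_mul_log {m : ℕ} (hm : 1 ≤ m) :
    (harmonic m : ℝ) ≤ 3 * Real.log ((m : ℝ) + 1) := by
  have hm' : (1 : ℝ) ≤ m := by exact_mod_cast hm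
  have hlog : Real.log m ≤ Real.log ((m : ℝ) + 1) := Real.log_le_log (by linarith) (by linarith)
  have hlog2 : Real.log 2 ≤ Real.log ((m : ℝ) + 1) := Real.log_le_log (by norm_num) (by linarith)
  linarith [harmonic_le_one_add_log m, Real.log_two_gt_d9]

section UpperBound

variable {𝕜 X : Type*} [RCLike 𝕜] [NormedAddCommGroup X] [NormedSpace 𝕜 X]
  {b : SchauderBasis 𝕜 X} {w : ℕ → ℝ} {hw : IsNonincreasingWeight w}

theorem IsNormedBy.mul_le_norm_div (hb : IsNormedBy b hw) (x : X) {A : Finset ℕ} {τ : ℝ}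
    (hA : A.Nonempty) (hτ : ∀ n ∈ A, τ ≤ ‖b.coord n x‖) : w A.card * τ ≤ ‖x‖ / A.card := by
  rw [le_div_iff₀' (by exact_mod_cast hA.card_pos)]
  calc A.card * (w A.card * τ)
      = w A.card * (A.card * τ) := mul_left_comm _ _ _
    _ ≤ w A.card * ∑ n ∈ A, ‖b.coord n x‖ := by
        refine mul_le_mul_of_nonneg_left ?_ (hw.nonneg _ hA.card_pos)
        simpa using Finset.card_nsmul_le_sum A _ τ hτ
    _ ≤ primitiveSeq w A.card / A.card * ∑ n ∈ A, ‖b.coord n x‖ := by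
        gcongr
        exact hw.le_primitiveSeq_div hA.card_pos le_rfl
    _ ≤ ‖x‖ := hb.primitiveSeq_div_mul_sum_norm_coord_le x A

theorem IsNormedBy.norm_proj_le (hb : IsNormedBy b hw) (A : Finset ℕ) :
    ‖GeneralSchauderBasis.proj b A‖ ≤ harmonic A.card := by
  have hH : (0 : ℝ) ≤ harmonic A.card := by
    exact_mod_cast harmonic_zero.symm.trans_le (harmonic_mono A.card.zero_le)
  refine ContinuousLinearMap.opNorm_le_bound _ hH fun x => hb.norm_le fun B N => ?_
  simp only [GeneralSchauderBasis.proj_apply, coord_sum_smul_basis]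
  have habel := sum_mul_add_le_primitiveSeq (sum_normingCoeff_le hw B)
    (d := fun j => ‖x‖ / j) (fun E τ => hb.mul_le_norm_div x (A := E)) A
    (fun n _ => norm_nonneg (b.coord n x))
  calc normingSeminorm hw B N (fun n => if n ∈ A then b.coord n x else 0)
      ≤ ∑ n ∈ A, normingCoeff w B n * ‖if n ∈ A then b.coord n x else 0‖ :=
        normingSeminorm_le_sum hw (fun n hn => if_neg hn) B N
    _ = ∑ n ∈ A, normingCoeff w B n * ‖b.coord n x‖ :=
        Finset.sum_congr rfl fun n hn => by rw [if_pos hn]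
    _ ≤ primitiveSeq (fun j => ‖x‖ / j) A.card := by simpa using habel
    _ = harmonic A.card * ‖x‖ := by
        simp [primitiveSeq, harmonic_eq_sum_Icc, Finset.sum_mul, inv_mul_eq_div]

theorem IsNormedBy.uncondParam_le (hb : IsNormedBy b hw) (m : ℕ) :
    uncondParam b m ≤ ENNReal.ofReal (harmonic m) := by
  refine iSup₂_le fun A hA => ?_
  rw [← ofReal_norm]
  exact ENNReal.ofReal_le_ofReal
    ((hb.norm_proj_le A).trans (by exact_mod_cast harmonic_mono hA))

end UpperBound

/-! ### The unconditionality parameters: lower bound -/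

section AlternatingSums

variable {u : ℕ → ℝ}

theorem alternating_sum_mem_Icc (hu : Antitone u) (hu0 : ∀ n, 0 ≤ u n) (n : ℕ) :
    ∑ k ∈ Finset.range n, (-1) ^ k * u k ∈ Set.Icc 0 (u 0) := by
  induction n generalizing u with
  | zero => simp [hu0]
  | succ n ih =>
    obtain ⟨hlow, hupp⟩ :=
      ih (u := fun k => u (k + 1)) (fun i j hij => hu (by omega)) fun k => hu0 _
    have hfirst : u (0 + 1) ≤ u 0 := hu (Nat.zero_le _)
    rw [Finset.sum_range_succ']
    simp only [pow_succ, pow_zero, one_mul, mul_neg, mul_one, neg_mul, Finset.sum_neg_distrib]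
    constructor <;> linarith

theorem abs_alternating_sum_sdiff_le (hu : Antitone u) (hu0 : ∀ n, 0 ≤ u n) (n : ℕ)
    (B : Finset ℕ) : |∑ k ∈ Finset.range n \ B, (-1) ^ k * u k| ≤ u 0 + ∑ k ∈ B, u k := by
  obtain ⟨hlow, hupp⟩ := alternating_sum_mem_Icc hu hu0 n
  have hinter : |∑ k ∈ Finset.range n ∩ B, (-1) ^ k * u k| ≤ ∑ k ∈ B, u k :=
    calc |∑ k ∈ Finset.range n ∩ B, (-1) ^ k * u k|
        ≤ ∑ k ∈ Finset.range n ∩ B, |(-1) ^ k * u k| := Finset.abs_sum_le_sum_abs _ _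
      _ = ∑ k ∈ Finset.range n ∩ B, u k :=
          Finset.sum_congr rfl fun k _ => by simp [abs_mul, abs_of_nonneg (hu0 k)]
      _ ≤ ∑ k ∈ B, u k :=
          Finset.sum_le_sum_of_subset_of_nonneg Finset.inter_subset_right fun k _ _ => hu0 k
  rw [abs_le] at hinter ⊢
  have hsplit := Finset.sum_inter_add_sum_sdiff (Finset.range n) B fun k => (-1) ^ k * u k
  have := hu0 0
  constructor <;> linarith

theorem sum_range_le_two_mul_sum_filter_even (hu : Antitone u) (hu0 : ∀ n, 0 ≤ u n) (n : ℕ) :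
    ∑ k ∈ Finset.range n, u k ≤ 2 * ∑ k ∈ Finset.range n with Even k, u k := by
  have halt := (alternating_sum_mem_Icc hu hu0 n).1
  have hsum : ∑ k ∈ Finset.range n, (-1) ^ k * u k + ∑ k ∈ Finset.range n, u k =
      2 * ∑ k ∈ Finset.range n with Even k, u k := by
    rw [Finset.sum_filter, Finset.mul_sum, ← Finset.sum_add_distrib]
    refine Finset.sum_congr rfl fun k _ => ?_
    rcases Nat.even_or_odd k with hk | hk
    · rw [hk.neg_one_pow, if_pos hk]
      ring
    · rw [hk.neg_one_pow, if_neg (Nat.not_even_iff_odd.mpr hk)]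
      ring
  linarith

theorem sum_le_sum_range_card_of_antitone (hu : Antitone u) (A : Finset ℕ) :
    ∑ n ∈ A, u n ≤ ∑ n ∈ Finset.range A.card, u n := by
  induction A using Finset.induction_on_max with
  | empty => simp
  | insert q A hq ih =>
    have hqA : q ∉ A := fun h => lt_irrefl _ (hq q h)
    have hcard : A.card ≤ q := by
      simpa using Finset.card_le_card (fun n hn => Finset.mem_range.mpr (hq n hn) :
        A ⊆ Finset.range q)
    rw [Finset.sum_insert hqA, Finset.card_insert_of_notMem hqA, Finset.sum_range_succ]
    linarith [hu hcard]

end AlternatingSums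

/-- The sequence `c`, indexed from `0`, is non-increasing and non-negative, and it belongs to the
ball of radius `K` of the Marcinkiewicz space whose norm is `sup_n (σ[w]_n / n) ∑_{k < n} c_k` on
such sequences. -/
structure MarcinkiewiczBound (w c : ℕ → ℝ) (K : ℝ) : Prop where
  antitone : Antitone c
  nonneg : ∀ n, 0 ≤ c n
  primitiveSeq_mul_sum_le : ∀ n : ℕ, primitiveSeq w n * ∑ k ∈ Finset.range n, c k ≤ K * n

namespace MarcinkiewiczBound

variable {w c : ℕ → ℝ} {K : ℝ}

theorem weight_one_mul_le (hc : MarcinkiewiczBound w c K) : w 1 * c 0 ≤ K := by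
  simpa using hc.primitiveSeq_mul_sum_le 1

theorem bound_nonneg (hc : MarcinkiewiczBound w c K) (hw : IsNonincreasingWeight w) : 0 ≤ K :=
  (mul_nonneg hw.pos_one.le (hc.nonneg 0)).trans hc.weight_one_mul_le

theorem primitiveSeq_div_mul_sum_le (hc : MarcinkiewiczBound w c K) (hw : IsNonincreasingWeight w)
    (B : Finset ℕ) : primitiveSeq w B.card / B.card * ∑ k ∈ B, c k ≤ K := by
  rcases B.eq_empty_or_nonempty with rfl | hB
  · simpa using hc.bound_nonneg hw
  · rw [div_mul_eq_mul_div, div_le_iff₀ (by exact_mod_cast hB.card_pos)]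
    exact (mul_le_mul_of_nonneg_left (sum_le_sum_range_card_of_antitone hc.antitone B)
      (hw.primitiveSeq_nonneg _)).trans (hc.primitiveSeq_mul_sum_le _)

theorem weight_mul_sum_le (hc : MarcinkiewiczBound w c K) (hw : IsNonincreasingWeight w)
    (B : Finset ℕ) : w (B.card + 1) * ∑ k ∈ B, c k ≤ K := by
  rcases B.eq_empty_or_nonempty with rfl | hB
  · simpa using hc.bound_nonneg hw
  · exact (mul_le_mul_of_nonneg_right (hw.le_primitiveSeq_div hB.card_pos (Nat.le_succ _))
      (Finset.sum_nonneg fun k _ => hc.nonneg k)).trans (hc.primitiveSeq_div_mul_sum_le hw B)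

theorem antitone_weight_mul (hc : MarcinkiewiczBound w c K) (hw : IsNonincreasingWeight w)
    (m : ℕ) : Antitone fun k => w (m + k + 1) * c k := fun i j hij =>
  mul_le_mul (hw.antitone_shift m hij) (hc.antitone hij) (hc.nonneg j) (hw.nonneg _ (by omega))

theorem weight_mul_nonneg (hc : MarcinkiewiczBound w c K) (hw : IsNonincreasingWeight w)
    (m k : ℕ) : 0 ≤ w (m + k + 1) * c k :=
  mul_nonneg (hw.nonneg _ (by omega)) (hc.nonneg k)

theorem normingSeminorm_alternating_le (𝕜 : Type*) [RCLike 𝕜] (hc : MarcinkiewiczBound w c K)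
    (hw : IsNonincreasingWeight w) (B : Finset ℕ) (N : ℕ) :
    normingSeminorm hw B N (fun k => (((-1) ^ k * c k : ℝ) : 𝕜)) ≤ 2 * K := by
  have hnorm (k : ℕ) : ‖(((-1) ^ k * c k : ℝ) : 𝕜)‖ = c k := by
    rw [RCLike.norm_ofReal, abs_mul, abs_neg_one_pow, one_mul, abs_of_nonneg (hc.nonneg k)]
  have hreal : ∑ k ∈ Finset.range N \ B, (w (B.card + k + 1) : 𝕜) * (((-1) ^ k * c k : ℝ) : 𝕜) =
      ((∑ k ∈ Finset.range N \ B, (-1) ^ k * (w (B.card + k + 1) * c k) : ℝ) : 𝕜) := by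
    rw [RCLike.ofReal_sum]
    exact Finset.sum_congr rfl fun k _ => by rw [← RCLike.ofReal_mul, mul_left_comm]
  have hcond : |∑ k ∈ Finset.range N \ B, (-1) ^ k * (w (B.card + k + 1) * c k)| ≤ K + K :=
    calc |∑ k ∈ Finset.range N \ B, (-1) ^ k * (w (B.card + k + 1) * c k)|
        ≤ w (B.card + 0 + 1) * c 0 + ∑ k ∈ B, w (B.card + k + 1) * c k :=
          abs_alternating_sum_sdiff_le (hc.antitone_weight_mul hw _)
            (hc.weight_mul_nonneg hw _) N B
      _ ≤ w 1 * c 0 + w (B.card + 1) * ∑ k ∈ B, c k := by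
          rw [Finset.mul_sum]
          refine add_le_add (mul_le_mul_of_nonneg_right ?_ (hc.nonneg 0))
            (Finset.sum_le_sum fun k _ => mul_le_mul_of_nonneg_right ?_ (hc.nonneg k))
          · exact hw.nonincreasing _ _ le_rfl (by omega)
          · exact hw.nonincreasing _ _ (by omega) (by omega)
      _ ≤ K + K := add_le_add hc.weight_one_mul_le (hc.weight_mul_sum_le hw B)
  rw [normingSeminorm_apply, hreal, RCLike.norm_ofReal]
  simp only [hnorm]
  linarith [hc.primitiveSeq_div_mul_sum_le hw B]

end MarcinkiewiczBound

section LowerBound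

variable {𝕜 X : Type*} [RCLike 𝕜] [NormedAddCommGroup X] [NormedSpace 𝕜 X]
  {b : SchauderBasis 𝕜 X} {w c : ℕ → ℝ} {K : ℝ} {hw : IsNonincreasingWeight w}

/-- The vector whose first `N` coefficients are `c 0, -c 1, c 2, …` and whose other coefficients
vanish: cancellation makes it small for the summands of the norming seminorms that are sensitive
to partial sums, which projecting onto the even indices undoes. -/
noncomputable def alternatingVector (b : SchauderBasis 𝕜 X) (c : ℕ → ℝ) (N : ℕ) : X :=
  ∑ k ∈ Finset.range N, (((-1) ^ k * c k : ℝ) : 𝕜) • b k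

theorem coord_alternatingVector (b : SchauderBasis 𝕜 X) (c : ℕ → ℝ) (N k : ℕ) :
    b.coord k (alternatingVector b c N) =
      (Set.Iio N).indicator (fun k => (((-1) ^ k * c k : ℝ) : 𝕜)) k := by
  rw [alternatingVector, coord_sum_smul_basis, Set.indicator_apply]
  simp only [Finset.mem_range, Set.mem_Iio]

theorem IsNormedBy.norm_alternatingVector_le (hb : IsNormedBy b hw)
    (hc : MarcinkiewiczBound w c K) (N : ℕ) : ‖alternatingVector b c N‖ ≤ 2 * K :=
  hb.norm_le fun B M => by
    simp only [coord_alternatingVector]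
    exact (normingSeminorm_indicator_le hw B M N _).trans
      (hc.normingSeminorm_alternating_le 𝕜 hw B _)

theorem IsNormedBy.sum_le_norm_proj_alternatingVector (hb : IsNormedBy b hw)
    (hc : MarcinkiewiczBound w c K) (N : ℕ) :
    1 / 4 * ∑ k ∈ Finset.range N, w (k + 1) * c k ≤
      ‖GeneralSchauderBasis.proj b {k ∈ Finset.range N | Even k} (alternatingVector b c N)‖ := by
  set x := GeneralSchauderBasis.proj b {k ∈ Finset.range N | Even k} (alternatingVector b c N)
  have hcoord (k : ℕ) (hk : k ∈ Finset.range N) :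
      b.coord k x = ((if Even k then c k else 0 : ℝ) : 𝕜) := by
    simp only [x, GeneralSchauderBasis.proj_apply, coord_sum_smul_basis]
    rw [coord_alternatingVector, Set.indicator_of_mem (Set.mem_Iio.mpr (Finset.mem_range.mp hk))]
    split_ifs with h h' h'
    · rw [h'.neg_one_pow, one_mul]
    · exact absurd (Finset.mem_filter.mp h).2 h'
    · exact absurd (Finset.mem_filter.mpr ⟨hk, h'⟩) h
    · rw [RCLike.ofReal_zero]
  have hsum : ∑ k ∈ Finset.range N, (w (k + 1) : 𝕜) * b.coord k x =
      ((∑ k ∈ Finset.range N with Even k, w (k + 1) * c k : ℝ) : 𝕜) := by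
    rw [Finset.sum_filter, RCLike.ofReal_sum]
    refine Finset.sum_congr rfl fun k hk => ?_
    rw [hcoord k hk, ← RCLike.ofReal_mul, mul_ite, mul_zero]
  have heven := sum_range_le_two_mul_sum_filter_even (hc.antitone_weight_mul hw 0)
    (hc.weight_mul_nonneg hw 0) N
  have hx := hb.normingSeminorm_le x ∅ N
  simp only [normingSeminorm_apply, Finset.sum_empty, mul_zero, zero_add, Finset.card_empty,
    Finset.sdiff_empty, hsum, RCLike.norm_ofReal] at hx heven
  linarith [le_abs_self (∑ k ∈ Finset.range N with Even k, w (k + 1) * c k)]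

theorem IsNormedBy.le_uncondParamTilde (hb : IsNormedBy b hw) (hc : MarcinkiewiczBound w c K)
    (hK : 0 < K) (N : ℕ) :
    ENNReal.ofReal ((∑ k ∈ Finset.range N, w (k + 1) * c k) / (8 * K)) ≤ uncondParamTilde b N := by
  have hnorm : ‖(((2 * K)⁻¹ : ℝ) : 𝕜)‖ = (2 * K)⁻¹ := by
    rw [RCLike.norm_ofReal, abs_of_pos (by positivity)]
  refine le_iSup₂_of_le {k ∈ Finset.range N | Even k}
    ((((2 * K)⁻¹ : ℝ) : 𝕜) • alternatingVector b c N) (le_iSup₂_of_le ?_ (fun n hn => ?_) ?_)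
  · rw [norm_smul, hnorm, inv_mul_le_iff₀ (by positivity), mul_one]
    exact hb.norm_alternatingVector_le hc N
  · rw [map_smul, coord_alternatingVector, Set.indicator_of_notMem (by simpa using hn), smul_zero]
  · rw [← ofReal_norm, map_smul, norm_smul, hnorm]
    refine ENNReal.ofReal_le_ofReal ?_
    rw [inv_mul_eq_div, div_le_div_iff₀ (by positivity) (by positivity)]
    nlinarith [hb.sum_le_norm_proj_alternatingVector hc N]

end LowerBound

/-! ### Conditionality -/

theorem primitiveSeq_eq_sum_range (w : ℕ → ℝ) (m : ℕ) :
    primitiveSeq w m = ∑ k ∈ Finset.range m, w (k + 1) :=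
  (Finset.range_eq_Ico m ▸ Finset.sum_Ico_add' w 0 m 1).symm

/-- The flat sequence of length `M` whose pairing with the weight `w` is `1`. -/
noncomputable def flatSeq (w : ℕ → ℝ) (M : ℕ) : ℕ → ℝ :=
  (Set.Iio M).indicator fun _ => (primitiveSeq w M)⁻¹

theorem sum_range_flatSeq (w : ℕ → ℝ) (M n : ℕ) :
    ∑ k ∈ Finset.range n, flatSeq w M k = (min n M : ℕ) / primitiveSeq w M := by
  have hfilter : {k ∈ Finset.range n | k < M} = Finset.range (min n M) := by
    ext k
    simp
  simp only [flatSeq, Set.indicator_apply, Set.mem_Iio]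
  rw [← Finset.sum_filter, hfilter, Finset.sum_const, Finset.card_range, nsmul_eq_mul,
    div_eq_mul_inv]

namespace IsNonincreasingWeight

variable {w : ℕ → ℝ}

theorem sum_mul_flatSeq (hw : IsNonincreasingWeight w) {M : ℕ} (hM : 1 ≤ M) :
    ∑ k ∈ Finset.range M, w (k + 1) * flatSeq w M k = 1 := by
  rw [← mul_inv_cancel₀ (hw.primitiveSeq_pos hM).ne', primitiveSeq_eq_sum_range w M,
    Finset.sum_mul, ← primitiveSeq_eq_sum_range]
  exact Finset.sum_congr rfl fun k hk => by
    rw [flatSeq, Set.indicator_of_mem (Set.mem_Iio.mpr (Finset.mem_range.mp hk))]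

theorem marcinkiewiczBound_flatSeq (hw : IsNonincreasingWeight w) {M : ℕ} (hM : 1 ≤ M) :
    MarcinkiewiczBound w (flatSeq w M) 1 where
  nonneg := Set.indicator_nonneg fun _ _ => (inv_pos.mpr (hw.primitiveSeq_pos hM)).le
  antitone i j hij := by
    by_cases hj : j < M
    · rw [flatSeq, Set.indicator_of_mem (Set.mem_Iio.mpr hj),
        Set.indicator_of_mem (Set.mem_Iio.mpr (hij.trans_lt hj))]
    · rw [flatSeq, Set.indicator_of_notMem (by simpa using hj)]
      exact Set.indicator_nonneg (fun _ _ => (inv_pos.mpr (hw.primitiveSeq_pos hM)).le) i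
  primitiveSeq_mul_sum_le n := by
    rw [sum_range_flatSeq, ← mul_div_assoc, div_le_iff₀ (hw.primitiveSeq_pos hM), one_mul]
    rcases le_total n M with hn | hn
    · rw [min_eq_left hn, mul_comm]
      exact mul_le_mul_of_nonneg_left (hw.primitiveSeq_monotone hn) n.cast_nonneg
    · rw [min_eq_right hn, mul_comm]
      exact hw.mul_primitiveSeq_le hn

theorem primitiveSeq_mul_sum_flatSeq_le (hw : IsNonincreasingWeight w) {n L M : ℕ} {ε : ℝ}
    (hnL : n ≤ L) (hM : 1 ≤ M) (hLM : primitiveSeq w L ≤ ε * primitiveSeq w M) :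
    primitiveSeq w n * ∑ k ∈ Finset.range n, flatSeq w M k ≤ ε * n := by
  have hpos := hw.primitiveSeq_pos hM
  rw [sum_range_flatSeq, ← mul_div_assoc, div_le_iff₀ hpos]
  calc primitiveSeq w n * (min n M : ℕ)
      ≤ (ε * primitiveSeq w M) * n := by
        refine mul_le_mul ((hw.primitiveSeq_monotone hnL).trans hLM) ?_ (Nat.cast_nonneg _)
          ((hw.primitiveSeq_nonneg L).trans hLM)
        exact_mod_cast min_le_left n M
    _ = ε * n * primitiveSeq w M := by ring

theorem exists_forall_primitiveSeq_mul_le (hw : IsNonincreasingWeight w)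
    (hdual : UnboundedSeq (dualSeq (primitiveSeq w))) (S : ℝ) {ε : ℝ} (hε : 0 < ε) :
    ∃ L, ∀ n, L ≤ n → primitiveSeq w n * S ≤ ε * n := by
  obtain ⟨L, hL, hSL⟩ := hdual (S / ε)
  refine ⟨L, fun n hn => ?_⟩
  have hlt := hSL.trans_le (hw.dualSeq_primitiveSeq_monotone hn)
  rw [dualSeq, div_lt_div_iff₀ hε (hw.primitiveSeq_pos (hL.trans hn))] at hlt
  linarith

end IsNonincreasingWeight

-- A long flat sequence has small averages where those of `c` may be large, and vice versa.
theorem MarcinkiewiczBound.exists_add_flatSeq {w c : ℕ → ℝ} {K ε : ℝ} {N : ℕ}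
    (hc : MarcinkiewiczBound w c K) (hw : IsNonincreasingWeight w)
    (hunb : UnboundedSeq (primitiveSeq w)) (hdual : UnboundedSeq (dualSeq (primitiveSeq w)))
    (hK : 1 ≤ K) (hε : 0 < ε) (hcN : ∀ n, N ≤ n → c n = 0) :
    ∃ M, 1 ≤ M ∧ N ≤ M ∧ MarcinkiewiczBound w (c + flatSeq w M) (K + ε) := by
  obtain ⟨L, hL⟩ := hw.exists_forall_primitiveSeq_mul_le hdual (∑ k ∈ Finset.range N, c k) hε
  obtain ⟨M, hM, hLM⟩ := hunb (primitiveSeq w L / ε)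
  have hLM' : primitiveSeq w L ≤ ε * primitiveSeq w (max M N) := by
    rw [← div_le_iff₀' hε]
    exact hLM.le.trans (hw.primitiveSeq_monotone (le_max_left _ _))
  have hmax : 1 ≤ max M N := hM.trans (le_max_left _ _)
  have hflat := hw.marcinkiewiczBound_flatSeq hmax
  have hsum (n : ℕ) : ∑ k ∈ Finset.range n, c k ≤ ∑ k ∈ Finset.range N, c k := by
    rw [Finset.sum_subset (Finset.range_mono (le_max_left N n)) fun k _ hk =>
      hcN k (by simpa using hk)]
    exact Finset.sum_le_sum_of_subset_of_nonneg (Finset.range_mono (le_max_right _ _))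
      fun k _ _ => hc.nonneg k
  refine ⟨max M N, hmax, le_max_right _ _, hc.antitone.add hflat.antitone,
    fun n => add_nonneg (hc.nonneg n) (hflat.nonneg n), fun n => ?_⟩
  simp only [Pi.add_apply, Finset.sum_add_distrib, mul_add, add_mul]
  rcases le_total n L with hn | hn
  · exact add_le_add (hc.primitiveSeq_mul_sum_le n)
      (hw.primitiveSeq_mul_sum_flatSeq_le hn hmax hLM')
  · have hcn := (mul_le_mul_of_nonneg_left (hsum n) (hw.primitiveSeq_nonneg n)).trans (hL n hn)
    have hKn : (1 : ℝ) * n ≤ K * n := by gcongr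
    linarith [hflat.primitiveSeq_mul_sum_le n]

theorem IsNonincreasingWeight.exists_marcinkiewiczBound {w : ℕ → ℝ} (hw : IsNonincreasingWeight w)
    (hunb : UnboundedSeq (primitiveSeq w)) (hdual : UnboundedSeq (dualSeq (primitiveSeq w)))
    (j : ℕ) {ε : ℝ} (hε : 0 < ε) :
    ∃ (c : ℕ → ℝ) (N : ℕ), MarcinkiewiczBound w c (1 + j * ε) ∧ (∀ n, N ≤ n → c n = 0) ∧
      ∑ k ∈ Finset.range N, w (k + 1) * c k = j := by
  induction j with
  | zero => exact ⟨0, 0, ⟨antitone_const, fun _ => le_rfl, by simp⟩, by simp, by simp⟩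
  | succ j ih =>
    obtain ⟨c, N, hc, hcN, hpair⟩ := ih
    obtain ⟨M, hM, hNM, hbound⟩ := hc.exists_add_flatSeq hw hunb hdual
      (le_add_of_nonneg_right (by positivity)) hε hcN
    refine ⟨c + flatSeq w M, M, by convert hbound using 1; push_cast; ring, fun n hn => ?_, ?_⟩
    · rw [Pi.add_apply, hcN n (hNM.trans hn), flatSeq,
        Set.indicator_of_notMem (by simpa using hn), add_zero]
    · simp only [Pi.add_apply, mul_add, Finset.sum_add_distrib, hw.sum_mul_flatSeq hM]
      rw [← Finset.sum_subset (Finset.range_mono hNM) fun k _ hk => by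
        rw [hcN k (by simpa using hk), mul_zero], hpair, Nat.cast_succ]

section Conditionality

variable {𝕜 X : Type*} [RCLike 𝕜] [NormedAddCommGroup X] [NormedSpace 𝕜 X] [CompleteSpace X]
  {b : SchauderBasis 𝕜 X} {w : ℕ → ℝ} {hw : IsNonincreasingWeight w}

theorem IsUnconditional.exists_norm_proj_le (h : IsUnconditional b) :
    ∃ C : ℝ, ∀ A : Finset ℕ, ‖GeneralSchauderBasis.proj b A‖ ≤ C := by
  let b' : UnconditionalSchauderBasis ℕ 𝕜 X :=
    { basis := b.basis
      coord := b.coord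
      ortho := b.ortho
      expansion := fun x => by
        have hsum := (h x).hasSum
        have hproj := b.tendsto_proj x
        simp only [SchauderBasis.proj_apply] at hproj
        rwa [tendsto_nhds_unique hsum.tendsto_sum_nat hproj] at hsum }
  exact UnconditionalSchauderBasis.exists_norm_proj_le b'

theorem IsUnconditional.exists_uncondParam_le (h : IsUnconditional b) :
    ∃ C : ℝ, 0 ≤ C ∧ ∀ m, uncondParam b m ≤ ENNReal.ofReal C := by
  obtain ⟨C, hC⟩ := h.exists_norm_proj_le
  refine ⟨C, (norm_nonneg _).trans (hC ∅), fun m => iSup₂_le fun A _ => ?_⟩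
  rw [← ofReal_norm]
  exact ENNReal.ofReal_le_ofReal (hC A)

theorem IsNormedBy.not_isUnconditional (hb : IsNormedBy b hw)
    (hunb : UnboundedSeq (primitiveSeq w)) (hdual : UnboundedSeq (dualSeq (primitiveSeq w))) :
    ¬ IsUnconditional b := by
  intro h
  obtain ⟨C, hC0, hC⟩ := h.exists_uncondParam_le
  obtain ⟨j, hj⟩ := exists_nat_gt (16 * C)
  have hj0 : (0 : ℝ) < j := (mul_nonneg (by norm_num) hC0).trans_lt hj
  obtain ⟨c, N, hc, -, hpair⟩ := hw.exists_marcinkiewiczBound hunb hdual j (inv_pos.mpr hj0)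
  rw [mul_inv_cancel₀ hj0.ne', one_add_one_eq_two] at hc
  have hle := ((hb.le_uncondParamTilde hc two_pos N).trans
    (uncondParamTilde_le_uncondParam b N)).trans (hC N)
  rw [hpair, ENNReal.ofReal_le_ofReal_iff hC0] at hle
  linarith

end Conditionality

/-! ### Regularity of sequences -/

theorem dualSeq_pos {s : ℕ → ℝ} (hs : ∀ m, 1 ≤ m → 0 < s m) (m : ℕ) (hm : 1 ≤ m) :
    0 < dualSeq s m :=
  div_pos (Nat.cast_pos.mpr hm) (hs m hm)

theorem UnboundedSeq.of_seqEquiv {p s : ℕ → ℝ} (hps : SeqEquiv p s) (h : UnboundedSeq s) :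
    UnboundedSeq p := by
  obtain ⟨C, hC, hCps⟩ := hps
  intro K
  obtain ⟨m, hm, hmK⟩ := h (C * K)
  exact ⟨m, hm, lt_of_mul_lt_mul_left (hmK.trans_le (hCps m hm).2) hC.le⟩

theorem SeqEquiv.dualSeq {p s : ℕ → ℝ} (hps : SeqEquiv p s) (hp : ∀ m, 1 ≤ m → 0 < p m)
    (hs : ∀ m, 1 ≤ m → 0 < s m) : SeqEquiv (dualSeq p) (dualSeq s) := by
  obtain ⟨C, hC, hCps⟩ := hps
  have hinv {m : ℕ} {x y : ℝ} (hx : 0 < x) (hy : 0 < y) (hyx : y ≤ C * x) :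
      (m : ℝ) / x ≤ C * (m / y) := by
    rw [← mul_div_assoc, div_le_div_iff₀ hx hy]
    linarith [mul_le_mul_of_nonneg_left hyx (Nat.cast_nonneg (α := ℝ) m)]
  exact ⟨C, hC, fun m hm =>
    ⟨hinv (hp m hm) (hs m hm) (hCps m hm).2, hinv (hs m hm) (hp m hm) (hCps m hm).1⟩⟩

namespace LRP

variable {s : ℕ → ℝ}

theorem exists_factor (h : LRP s) (hs : ∀ m, 1 ≤ m → 0 < s m) (K : ℝ) :
    ∃ R : ℕ, 1 ≤ R ∧ ∀ n, 1 ≤ n → K * s n ≤ s (R * n) := by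
  obtain ⟨r, hr, hrs⟩ := h
  obtain ⟨j, hj⟩ := pow_unbounded_of_one_lt K (one_lt_two (α := ℝ))
  have hpow (j n : ℕ) (hn : 1 ≤ n) : 2 ^ j * s n ≤ s (r ^ j * n) := by
    induction j with
    | zero => simp
    | succ j ih =>
      calc 2 ^ (j + 1) * s n = 2 * (2 ^ j * s n) := by ring
        _ ≤ 2 * s (r ^ j * n) := by gcongr
        _ ≤ s (r * (r ^ j * n)) := hrs _ (Nat.mul_pos (pow_pos hr j) hn)
        _ = s (r ^ (j + 1) * n) := by rw [pow_succ', mul_assoc]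
  exact ⟨r ^ j, Nat.one_le_pow _ _ hr, fun n hn =>
    (mul_le_mul_of_nonneg_right hj.le (hs n hn).le).trans (hpow j n hn)⟩

theorem unboundedSeq (h : LRP s) (hs : ∀ m, 1 ≤ m → 0 < s m) : UnboundedSeq s := by
  intro C
  obtain ⟨R, hR, hRs⟩ := h.exists_factor hs ((C + 1) / s 1)
  have hle := hRs 1 le_rfl
  rw [div_mul_cancel₀ _ (hs 1 le_rfl).ne', mul_one] at hle
  exact ⟨R, hR, (lt_add_one C).trans_le hle⟩

theorem of_seqEquiv {p : ℕ → ℝ} (hps : SeqEquiv p s) (hs : ∀ m, 1 ≤ m → 0 < s m) (h : LRP s) :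
    LRP p := by
  obtain ⟨C, hC, hCps⟩ := hps
  obtain ⟨R, hR, hRs⟩ := h.exists_factor hs (2 * C ^ 2)
  refine ⟨R, hR, fun n hn => le_of_mul_le_mul_left ?_ hC⟩
  calc C * (2 * p n) ≤ C * (2 * (C * s n)) := by gcongr; exact (hCps n hn).1
    _ = 2 * C ^ 2 * s n := by ring
    _ ≤ s (R * n) := hRs n hn
    _ ≤ C * p (R * n) := (hCps _ (Nat.mul_pos hR hn)).2

end LRP

theorem sum_Ioc_div_le {u : ℕ → ℝ} {B : ℝ} {q n R : ℕ} (hB : 0 ≤ B)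
    (hu : ∀ k ∈ Finset.Ioc q n, u k ≤ B) (hn : n ≤ R * (q + 1)) :
    ∑ k ∈ Finset.Ioc q n, u k / k ≤ R * B := by
  have hterm : ∀ k ∈ Finset.Ioc q n, u k / k ≤ B / (q + 1) := fun k hk =>
    div_le_div₀ hB (hu k hk) (by positivity) (by exact_mod_cast (Finset.mem_Ioc.mp hk).1)
  have hcard : ((n - q : ℕ) : ℝ) ≤ R * (q + 1) := by exact_mod_cast (Nat.sub_le n q).trans hn
  calc ∑ k ∈ Finset.Ioc q n, u k / k ≤ (n - q : ℕ) * (B / (q + 1)) := by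
        simpa only [nsmul_eq_mul, Nat.card_Ioc] using Finset.sum_le_card_nsmul _ _ _ hterm
    _ ≤ R * (q + 1) * (B / (q + 1)) := by gcongr
    _ = R * B := by field_simp

-- With `q = n / R`, the sum over `k ≤ q` is at most half of the bound claimed for `n`, since
-- `u q ≤ u n / 2`, and the sum over the block `(q, n]` is at most the other half.
theorem LRP.exists_sum_div_le {s : ℕ → ℝ} (h : LRP s) (hs : ∀ m, 1 ≤ m → 0 < s m)
    (hinc : EssIncreasing s) :
    ∃ K : ℝ, 0 < K ∧ ∀ n, 1 ≤ n → ∑ k ∈ Finset.Icc 1 n, s k / k ≤ K * s n := by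
  obtain ⟨C, hC, hCs⟩ := hinc
  obtain ⟨R, hR, hRs⟩ := h.exists_factor hs (2 * C)
  have hhalf {q n : ℕ} (hq : 1 ≤ q) (hqn : R * q ≤ n) : 2 * s q ≤ s n := by
    have hle := (hRs q hq).trans (hCs _ n (Nat.mul_pos hR hq) hqn)
    exact le_of_mul_le_mul_left (by linarith) hC
  have hR2 : 2 ≤ R := by
    by_contra! hlt
    have := hhalf le_rfl (show R * 1 ≤ 1 by omega)
    linarith [hs 1 le_rfl]
  have hsplit {q n : ℕ} (hqn : q ≤ n) : ∑ k ∈ Finset.Icc 1 n, s k / k =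
      ∑ k ∈ Finset.Icc 1 q, s k / k + ∑ k ∈ Finset.Ioc q n, s k / k :=
    (Finset.sum_Ioc_consecutive _ q.zero_le hqn).symm
  refine ⟨2 * R * C, by positivity, fun n => ?_⟩
  induction n using Nat.strong_induction_on with
  | _ n ih =>
    intro hn
    have hsn := hs n hn
    have hlow : ∑ k ∈ Finset.Icc 1 (n / R), s k / k ≤ R * (C * s n) := by
      rcases Nat.eq_zero_or_pos (n / R) with hzero | hpos
      · rw [hzero, Finset.Icc_eq_empty_of_lt one_pos, Finset.sum_empty]
        positivity
      · calc _ ≤ 2 * R * C * s (n / R) := ih _ (Nat.div_lt_self hn hR2) hpos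
          _ = R * (C * (2 * s (n / R))) := by ring
          _ ≤ R * (C * s n) := by gcongr; exact hhalf hpos (Nat.mul_div_le n R)
    have hhigh : ∑ k ∈ Finset.Ioc (n / R) n, s k / k ≤ R * (C * s n) := by
      refine sum_Ioc_div_le (by positivity) (fun k hk => ?_) (Nat.lt_mul_div_succ n hR).le
      rw [Finset.mem_Ioc] at hk
      exact hCs k n (Nat.one_le_of_lt hk.1) hk.2
    rw [hsplit (Nat.div_le_self n R)]
    linarith

/-- The largest non-increasing minorant of `s k / k`, `k ≥ 1`: a non-increasing weight whose
primitive sequence is equivalent to `s` when `s` is regular. -/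
noncomputable def infRatio (s : ℕ → ℝ) (n : ℕ) : ℝ :=
  (Finset.Icc 1 (max n 1)).inf' (Finset.nonempty_Icc.mpr (le_max_right n 1)) fun k => s k / k

theorem infRatio_le (s : ℕ → ℝ) {n : ℕ} (hn : 1 ≤ n) : infRatio s n ≤ s n / n :=
  Finset.inf'_le _ (Finset.mem_Icc.mpr ⟨hn, le_max_left n 1⟩)

theorem isNonincreasingWeight_infRatio {s : ℕ → ℝ} (hs : ∀ m, 1 ≤ m → 0 < s m) :
    IsNonincreasingWeight (infRatio s) := by
  have hpos (n : ℕ) : 0 < infRatio s n := by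
    refine (Finset.lt_inf'_iff _).mpr fun k hk => ?_
    have hk1 := (Finset.mem_Icc.mp hk).1
    exact div_pos (hs k hk1) (Nat.cast_pos.mpr hk1)
  exact
    { nonneg := fun n _ => (hpos n).le
      pos_one := hpos 1
      nonincreasing := fun m n _ hmn => Finset.inf'_mono _
        (Finset.Icc_subset_Icc le_rfl (max_le_max hmn le_rfl)) _ }

theorem EssIncreasing.exists_le_mul_infRatio {s : ℕ → ℝ} (hdual : EssIncreasing (dualSeq s))
    (hs : ∀ m, 1 ≤ m → 0 < s m) :
    ∃ C : ℝ, 0 < C ∧ ∀ n, 1 ≤ n → s n ≤ C * (n * infRatio s n) := by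
  obtain ⟨C, hC, hCs⟩ := hdual
  refine ⟨C, hC, fun n hn => ?_⟩
  have hCn : 0 < C * n := mul_pos hC (Nat.cast_pos.mpr hn)
  rw [← mul_assoc, ← div_le_iff₀' hCn]
  refine Finset.le_inf' _ _ fun k hk => ?_
  rw [Finset.mem_Icc, max_eq_left hn] at hk
  have hkn := hCs k n hk.1 hk.2
  rw [dualSeq, dualSeq, ← mul_div_assoc, div_le_div_iff₀ (hs k hk.1) (hs n hn)] at hkn
  rw [div_le_div_iff₀ hCn (Nat.cast_pos.mpr hk.1), mul_comm]
  linarith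

theorem LRP.exists_weight {s : ℕ → ℝ} (h : LRP s) (hs : ∀ m, 1 ≤ m → 0 < s m)
    (hinc : EssIncreasing s) (hdual : EssIncreasing (dualSeq s)) :
    ∃ w : ℕ → ℝ, IsNonincreasingWeight w ∧ SeqEquiv (primitiveSeq w) s := by
  have hw := isNonincreasingWeight_infRatio hs
  obtain ⟨C, hC, hCs⟩ := hdual.exists_le_mul_infRatio hs
  obtain ⟨K, hK, hKs⟩ := h.exists_sum_div_le hs hinc
  refine ⟨infRatio s, hw, max K C, lt_max_of_lt_left hK, fun m hm => ⟨?_, ?_⟩⟩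
  · calc primitiveSeq (infRatio s) m ≤ ∑ k ∈ Finset.Icc 1 m, s k / k :=
          Finset.sum_le_sum fun k hk => infRatio_le s (Finset.mem_Icc.mp hk).1
      _ ≤ K * s m := hKs m hm
      _ ≤ max K C * s m := mul_le_mul_of_nonneg_right (le_max_left _ _) (hs m hm).le
  · calc s m ≤ C * (m * infRatio s m) := hCs m hm
      _ ≤ C * primitiveSeq (infRatio s) m :=
          mul_le_mul_of_nonneg_left (hw.card_mul_le_primitiveSeq le_rfl) hC.le
      _ ≤ max K C * primitiveSeq (infRatio s) m :=
          mul_le_mul_of_nonneg_right (le_max_right _ _) (hw.primitiveSeq_nonneg m)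

/-! ### Logarithmic growth -/

namespace IsNonincreasingWeight

variable {w : ℕ → ℝ}

theorem primitiveSeq_add_le (hw : IsNonincreasingWeight w) {n : ℕ} (hn : 1 ≤ n) (l : ℕ) :
    primitiveSeq w (n + l) ≤ primitiveSeq w n + l * w n := by
  induction l with
  | zero => simp
  | succ l ih =>
    rw [← add_assoc, primitiveSeq_succ, Nat.cast_succ]
    linarith [hw.nonincreasing n (n + l + 1) hn (by omega)]

theorem exists_primitiveSeq_le (hw : IsNonincreasingWeight w) (h : LRP (primitiveSeq w)) :
    ∃ R : ℝ, 0 < R ∧ ∀ n, 1 ≤ n → primitiveSeq w n ≤ R * (n * w n) := by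
  obtain ⟨r, hr, hrw⟩ := h
  refine ⟨r, Nat.cast_pos.mpr hr, fun n hn => ?_⟩
  have hnr : n ≤ r * n := Nat.le_mul_of_pos_left n hr
  have hadd := hw.primitiveSeq_add_le hn (r * n - n)
  rw [Nat.add_sub_cancel' hnr, Nat.cast_sub hnr, Nat.cast_mul] at hadd
  linarith [hrw n hn, mul_nonneg n.cast_nonneg (hw.nonneg n hn)]

theorem exists_marcinkiewiczBound_inv (hw : IsNonincreasingWeight w)
    (h : URP (primitiveSeq w)) :
    ∃ K : ℝ, 0 < K ∧ MarcinkiewiczBound w (fun k => (primitiveSeq w (k + 1))⁻¹) K := by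
  have hinc : EssIncreasing (dualSeq (primitiveSeq w)) := ⟨1, one_pos, fun m n _ hmn =>
    (hw.dualSeq_primitiveSeq_monotone hmn).trans_eq (one_mul _).symm⟩
  obtain ⟨K, hK, hKw⟩ :=
    LRP.exists_sum_div_le h (dualSeq_pos fun m hm => hw.primitiveSeq_pos hm) hinc
  have hpos (k : ℕ) := hw.primitiveSeq_pos (Nat.le_add_left 1 k)
  refine ⟨K, hK, fun i j hij => inv_anti₀ (hpos i) (hw.primitiveSeq_monotone (by gcongr)),
    fun k => (inv_pos.mpr (hpos k)).le, fun n => ?_⟩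
  rcases Nat.eq_zero_or_pos n with rfl | hn
  · simp
  have hsum : ∑ k ∈ Finset.range n, (primitiveSeq w (k + 1))⁻¹ =
      ∑ k ∈ Finset.Icc 1 n, dualSeq (primitiveSeq w) k / k := by
    rw [← primitiveSeq_eq_sum_range fun k => (primitiveSeq w k)⁻¹]
    refine Finset.sum_congr rfl fun k hk => ?_
    have hk0 : (k : ℝ) ≠ 0 :=
      Nat.cast_ne_zero.mpr (Nat.one_le_iff_ne_zero.mp (Finset.mem_Icc.mp hk).1)
    rw [dualSeq, div_right_comm, div_self hk0, one_div]
  calc primitiveSeq w n * ∑ k ∈ Finset.range n, (primitiveSeq w (k + 1))⁻¹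
      ≤ primitiveSeq w n * (K * dualSeq (primitiveSeq w) n) := by
        rw [hsum]
        exact mul_le_mul_of_nonneg_left (hKw n hn) (hw.primitiveSeq_nonneg n)
    _ = K * n := by
        rw [mul_left_comm, dualSeq, mul_div_cancel₀ _ (hw.primitiveSeq_pos hn).ne']

theorem exists_log_le_mul_sum (hw : IsNonincreasingWeight w) (h : LRP (primitiveSeq w)) :
    ∃ R : ℝ, 0 < R ∧ ∀ m : ℕ, Real.log ((m : ℝ) + 1) ≤
      R * ∑ k ∈ Finset.range m, w (k + 1) * (primitiveSeq w (k + 1))⁻¹ := by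
  obtain ⟨R, hR, hRw⟩ := hw.exists_primitiveSeq_le h
  refine ⟨R, hR, fun m => ?_⟩
  have hterm (k : ℕ) : ((k + 1 : ℕ) : ℝ)⁻¹ ≤ R * (w (k + 1) * (primitiveSeq w (k + 1))⁻¹) := by
    rw [← div_eq_mul_inv, ← mul_div_assoc, inv_eq_one_div,
      div_le_div_iff₀ (by positivity) (hw.primitiveSeq_pos (Nat.le_add_left 1 k))]
    linarith [hRw (k + 1) (Nat.le_add_left 1 k)]
  calc Real.log ((m : ℝ) + 1) ≤ harmonic m := by exact_mod_cast log_add_one_le_harmonic m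
    _ = ∑ k ∈ Finset.range m, ((k + 1 : ℕ) : ℝ)⁻¹ := by
        simp only [harmonic, Rat.cast_sum, Rat.cast_inv, Rat.cast_natCast]
    _ ≤ R * ∑ k ∈ Finset.range m, w (k + 1) * (primitiveSeq w (k + 1))⁻¹ := by
        rw [Finset.mul_sum]
        exact Finset.sum_le_sum fun k _ => hterm k

end IsNonincreasingWeight

section LogarithmicGrowth

variable {𝕜 X : Type*} [RCLike 𝕜] [NormedAddCommGroup X] [NormedSpace 𝕜 X]
  {b : SchauderBasis 𝕜 X} {w : ℕ → ℝ} {hw : IsNonincreasingWeight w}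

theorem IsNormedBy.exists_log_le_uncondParamTilde (hb : IsNormedBy b hw)
    (hlrp : LRP (primitiveSeq w)) (hurp : URP (primitiveSeq w)) :
    ∃ C : ℝ≥0, ∀ m : ℕ, ENNReal.ofReal (Real.log ((m : ℝ) + 1)) ≤ C * uncondParamTilde b m := by
  obtain ⟨R, hR, hlog⟩ := hw.exists_log_le_mul_sum hlrp
  obtain ⟨K, hK, hc⟩ := hw.exists_marcinkiewiczBound_inv hurp
  refine ⟨(R * (8 * K)).toNNReal, fun m => ?_⟩
  refine le_trans ?_ (mul_le_mul_right (hb.le_uncondParamTilde hc hK m) _)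
  rw [← ENNReal.ofReal, ← ENNReal.ofReal_mul (by positivity), mul_assoc,
    mul_div_cancel₀ _ (by positivity)]
  exact ENNReal.ofReal_le_ofReal (hlog m)

theorem IsNormedBy.uncondParam_le_log (hb : IsNormedBy b hw) {m : ℕ} (hm : 1 ≤ m) :
    uncondParam b m ≤ 3 * ENNReal.ofReal (Real.log ((m : ℝ) + 1)) := by
  refine (hb.uncondParam_le m).trans ?_
  rw [← ENNReal.ofReal_ofNat 3, ← ENNReal.ofReal_mul zero_le_three]
  exact ENNReal.ofReal_le_ofReal (harmonic_le_three_mul_log hm)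

theorem IsNormedBy.uncondParam_ennSeqEquiv_log (hb : IsNormedBy b hw)
    (hlrp : LRP (primitiveSeq w)) (hurp : URP (primitiveSeq w)) :
    ENNSeqEquiv (uncondParam b) (uncondParamTilde b) ∧
      ENNSeqEquiv (uncondParamTilde b) fun m => ENNReal.ofReal (Real.log ((m : ℝ) + 1)) := by
  obtain ⟨C, hC⟩ := hb.exists_log_le_uncondParamTilde hlrp hurp
  have htilde := uncondParamTilde_le_uncondParam b
  refine ⟨⟨max (3 * C) 1, fun m hm => ⟨?_, ?_⟩⟩, max 3 C, fun m hm => ⟨?_, ?_⟩⟩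
  · calc uncondParam b m ≤ 3 * (C * uncondParamTilde b m) :=
          (hb.uncondParam_le_log hm).trans (by gcongr; exact hC m)
      _ = (3 * C : ℝ≥0) * uncondParamTilde b m := by push_cast; ring
      _ ≤ (max (3 * C) 1 : ℝ≥0) * uncondParamTilde b m := by gcongr; exact le_max_left _ _
  · exact (htilde m).trans (le_mul_of_one_le_left' (by exact_mod_cast le_max_right (3 * C) 1))
  · exact ((htilde m).trans (hb.uncondParam_le_log hm)).trans
      (by gcongr; exact_mod_cast le_max_left 3 C)
  · exact (hC m).trans (by gcongr; exact le_max_right _ _)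

end LogarithmicGrowth

/-! ### Existence -/

theorem exists_isNormedBy_not_isUnconditional (𝕜 : Type u) [RCLike 𝕜] {w s : ℕ → ℝ}
    (hw : IsNonincreasingWeight w) (hs : ∀ m, 1 ≤ m → 0 < s m) (hps : SeqEquiv (primitiveSeq w) s)
    (hunb : UnboundedSeq s) (hdual : UnboundedSeq (dualSeq s)) :
    ∃ (X : Type u) (_ : NormedAddCommGroup X) (_ : NormedSpace 𝕜 X) (_ : CompleteSpace X)
      (b : SchauderBasis 𝕜 X), IsNormedBy b hw ∧ ¬ IsUnconditional b := by
  obtain ⟨X, _, _, hX, b, hb⟩ := exists_isNormedBy 𝕜 hw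
  have hdual' := hdual.of_seqEquiv (hps.dualSeq (fun _ => hw.primitiveSeq_pos) hs)
  exact ⟨X, _, _, hX, b, hb, hb.not_isUnconditional (hunb.of_seqEquiv hps) hdual'⟩

theorem dualSeq_sqrt : dualSeq (fun m : ℕ => √(m : ℝ)) = fun m : ℕ => √(m : ℝ) :=
  funext fun _ => Real.div_sqrt

theorem lrp_sqrt : LRP fun m : ℕ => √(m : ℝ) := by
  refine ⟨2 ^ 2, by norm_num, fun n _ => le_of_eq ?_⟩
  simp only [Nat.cast_mul, Nat.cast_pow, Nat.cast_ofNat]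
  rw [Real.sqrt_mul (by norm_num), Real.sqrt_sq zero_le_two]

theorem essIncreasing_sqrt : EssIncreasing fun m : ℕ => √(m : ℝ) :=
  ⟨1, one_pos, fun m n _ hmn => by
    rw [one_mul]
    exact Real.sqrt_le_sqrt (Nat.cast_le.mpr hmn)⟩

theorem exists_isNonincreasingWeight_seqEquiv_sqrt :
    ∃ w : ℕ → ℝ, IsNonincreasingWeight w ∧ SeqEquiv (primitiveSeq w) fun m : ℕ => √(m : ℝ) :=
  lrp_sqrt.exists_weight (fun _ hm => Real.sqrt_pos.mpr (Nat.cast_pos.mpr hm)) essIncreasing_sqrt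
    (dualSeq_sqrt.symm ▸ essIncreasing_sqrt)


theorem mainTheorem2 (𝕜 : Type u) [RCLike 𝕜] :
    -- a conditional bidemocratic Schauder basis with Property (A) exists
    (∃ (X : Type u) (_ : NormedAddCommGroup X) (_ : NormedSpace 𝕜 X) (_ : CompleteSpace X)
        (b : SchauderBasis 𝕜 X),
        IsBidemocratic b ∧ ¬ IsUnconditional b ∧ HasPropertyA b) ∧
    ∀ s : ℕ → ℝ, (∀ m, 1 ≤ m → 0 < s m) → EssIncreasing s → EssIncreasing (dualSeq s) →
      -- (C.1)
      (UnboundedSeq s → UnboundedSeq (dualSeq s) →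
        ∀ w : ℕ → ℝ, IsNonincreasingWeight w → SeqEquiv (primitiveSeq w) s →
        ∃ (X : Type u) (_ : NormedAddCommGroup X) (_ : NormedSpace 𝕜 X) (_ : CompleteSpace X)
          (b : SchauderBasis 𝕜 X),
          IsBidemocratic b ∧ ¬ IsUnconditional b ∧ HasPropertyA b ∧
          (∀ m, 1 ≤ m →
            fundamentalFunction 𝕜 b.basis m = ENNReal.ofReal (primitiveSeq w m)) ∧
          ENNSeqEquiv (fundamentalFunction 𝕜 b.basis) (fun m => ENNReal.ofReal (s m))) ∧
      -- (C.2)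
      (LRP s → UnboundedSeq (dualSeq s) →
        (∃ w : ℕ → ℝ, IsNonincreasingWeight w ∧ SeqEquiv (primitiveSeq w) s) ∧
        ∀ w : ℕ → ℝ, IsNonincreasingWeight w → SeqEquiv (primitiveSeq w) s →
        ∃ (X : Type u) (_ : NormedAddCommGroup X) (_ : NormedSpace 𝕜 X) (_ : CompleteSpace X)
          (b : SchauderBasis 𝕜 X),
          IsBidemocratic b ∧ ¬ IsUnconditional b ∧ HasPropertyA b ∧
          (∀ m, 1 ≤ m →
            fundamentalFunction 𝕜 b.basis m = ENNReal.ofReal (primitiveSeq w m)) ∧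
          ENNSeqEquiv (fundamentalFunction 𝕜 b.basis) (fun m => ENNReal.ofReal (s m))) ∧
      -- (C.3)
      (LRP s → URP s →
        (∃ w : ℕ → ℝ, IsNonincreasingWeight w ∧ SeqEquiv (primitiveSeq w) s) ∧
        ∀ w : ℕ → ℝ, IsNonincreasingWeight w → SeqEquiv (primitiveSeq w) s →
        ∃ (X : Type u) (_ : NormedAddCommGroup X) (_ : NormedSpace 𝕜 X) (_ : CompleteSpace X)
          (b : SchauderBasis 𝕜 X),
          IsBidemocratic b ∧ ¬ IsUnconditional b ∧ HasPropertyA b ∧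
          (∀ m, 1 ≤ m →
            fundamentalFunction 𝕜 b.basis m = ENNReal.ofReal (primitiveSeq w m)) ∧
          ENNSeqEquiv (fundamentalFunction 𝕜 b.basis) (fun m => ENNReal.ofReal (s m)) ∧
          ENNSeqEquiv (uncondParam b) (uncondParamTilde b) ∧
          ENNSeqEquiv (uncondParamTilde b)
            (fun m => ENNReal.ofReal (Real.log ((m : ℝ) + 1)))) := by
  refine ⟨?_, fun s hs hinc hdual => ⟨fun hunb hdunb w hw hps => ?_,
    fun hlrp hdunb => ⟨hlrp.exists_weight hs hinc hdual, fun w hw hps => ?_⟩,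
    fun hlrp hurp => ⟨hlrp.exists_weight hs hinc hdual, fun w hw hps => ?_⟩⟩⟩
  · have hpos (m : ℕ) (hm : 1 ≤ m) : 0 < √(m : ℝ) := Real.sqrt_pos.mpr (Nat.cast_pos.mpr hm)
    have hunb := lrp_sqrt.unboundedSeq hpos
    obtain ⟨w, hw, hps⟩ := exists_isNonincreasingWeight_seqEquiv_sqrt
    obtain ⟨X, _, _, hX, b, hb, hcond⟩ := exists_isNormedBy_not_isUnconditional 𝕜 hw hpos hps hunb
      (dualSeq_sqrt.symm ▸ hunb)
    exact ⟨X, _, _, hX, b, hb.isBidemocratic, hcond, hb.hasPropertyA⟩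
  · obtain ⟨X, _, _, hX, b, hb, hcond⟩ :=
      exists_isNormedBy_not_isUnconditional 𝕜 hw hs hps hunb hdunb
    exact ⟨X, _, _, hX, b, hb.isBidemocratic, hcond, hb.hasPropertyA,
      fun m _ => hb.fundamentalFunction_eq m, hb.fundamentalFunction_seqEquiv hps⟩
  · obtain ⟨X, _, _, hX, b, hb, hcond⟩ :=
      exists_isNormedBy_not_isUnconditional 𝕜 hw hs hps (hlrp.unboundedSeq hs) hdunb
    exact ⟨X, _, _, hX, b, hb.isBidemocratic, hcond, hb.hasPropertyA,
      fun m _ => hb.fundamentalFunction_eq m, hb.fundamentalFunction_seqEquiv hps⟩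
  · obtain ⟨X, _, _, hX, b, hb, hcond⟩ := exists_isNormedBy_not_isUnconditional 𝕜 hw hs hps
      (hlrp.unboundedSeq hs) (LRP.unboundedSeq hurp (dualSeq_pos hs))
    have hpurp : URP (primitiveSeq w) :=
      LRP.of_seqEquiv (hps.dualSeq (fun _ => hw.primitiveSeq_pos) hs) (dualSeq_pos hs) hurp
    exact ⟨X, _, _, hX, b, hb.isBidemocratic, hcond, hb.hasPropertyA,
      fun m _ => hb.fundamentalFunction_eq m, hb.fundamentalFunction_seqEquiv hps,
      hb.uncondParam_ennSeqEquiv_log (LRP.of_seqEquiv hps hs hlrp) hpurp⟩
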